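/- Let $p\in L_\infty[0,1]$ be a real function with $p\ge c$ almost everywhere for some constant $c>0$, let $q$ and $r$ be real elements of $W_2^{-1}[0,1]$ (bounded linear functionals $f\mapsto\int_0^1 q f\,dx$, $f\mapsto\int_0^1 r f\,dx$ on the complex Sobolev space $W_2^1[0,1]$ that take real values on real functions), and let $U$ be a diagonal unitary complex $2\times2$ matrix. For $y\in W_2^1[0,1]$ put $y^{\wedge}=(y(0),y(1))^{T}$, and let $$\mathfrak H_U=\{y\in W_2^1[0,1] : y^{\wedge}\in\operatorname{im}(U-1)\},\qquad \|y\|_{\mathfrak H_U}^2=\int_0^1\{|y'|^2+|y|^2\}\,dx .$$ Let $I:\mathfrak H_U\to L_2[0,1]$ be the embedding, let $\mathfrak H_U'$ be the completion of $L_2[0,1]$ in the norm $\|f\|=\|I^*f\|_{\mathfrak H_U}$, and let $I^+:\mathfrak H'_U\to\mathfrak H_U$ be the isometry that extends $I^*$ continuously. Let $V$ be the diagonal $2\times2$ matrix with $V_{kk}=-\cot\frac{\arg U_{kk}}{2}$ if $U_{kk}\ne1$ and $V_{kk}=0$ if $U_{kk}=1$. Let $T(\lambda):\mathfrak H_U\to\mathfrak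 H'_U$, $\lambda\in\mathbb C$, be the linear pencil of bounded operators determined by $$\langle I^+T(\lambda)y,y\rangle_{\mathfrak H_U}=\int_0^1p\,|y'|^2\,dx+\int_0^1(q-\lambda r)\cdot|y|^2\,dx+\langle Vy^{\wedge},y^{\wedge}\rangle_{\mathbb C^2},\qquad y\in\mathfrak H_U .$$ The index of inertia $\operatorname{ind}E$ of a bounded Hermitian operator $E$ on a Hilbert space $\mathfrak H$ is the supremum of the dimensions of the subspaces $\mathfrak M\subseteq\mathfrak H$ for which there is $c>0$ with $\langle Ey,y\rangle\le-c\|y\|^2$ for all $y\in\mathfrak M$. Let $\lambda\in\mathbb R$ be an eigenvalue of the pencil $T$ and let $y\in\mathfrak H_U$ be a corresponding eigenfunction, that is, $y\ne0$ and $T(\lambda)y=0$. Then $\operatorname{ind}I^+T(\lambda)$ equals the number of zeros in the open interval $(0,1)$ of (the continuous representative of) $y$. -/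

import Mathlib

open MeasureTheory Set
open scoped ENNReal ComplexConjugate

noncomputable section

namespace SturmLiouville

/-- Lebesgue measure on `[0,1]`. -/
abbrev unitMeasure : Measure ℝ := volume.restrict (Icc (0 : ℝ) 1)

/-- The complex Hilbert space `L₂[0,1]`. -/
abbrev L2 : Type := Lp ℂ 2 unitMeasure

instance : IsProbabilityMeasure unitMeasure := ⟨by simp⟩

theorem L2.integrable (g : L2) : Integrable g unitMeasure :=
  (Lp.memLp g).integrable (by norm_num)

theorem L2.intervalIntegrable (g : L2) {a b : ℝ} (ha : a ∈ Icc (0 : ℝ) 1)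
    (hb : b ∈ Icc (0 : ℝ) 1) : IntervalIntegrable g volume a b := by
  have h : IntegrableOn g (Icc (0 : ℝ) 1) volume := g.integrable
  exact (h.mono_set (uIcc_subset_Icc ha hb)).intervalIntegrable

theorem L2.integral_norm_le (g : L2) : ∫ x, ‖g x‖ ∂unitMeasure ≤ ‖g‖ := by
  rw [integral_norm_eq_lintegral_enorm g.integrable.aestronglyMeasurable, Lp.norm_def]
  refine ENNReal.toReal_mono (Lp.memLp g).eLpNorm_ne_top ?_
  rw [← eLpNorm_one_eq_lintegral_enorm]
  exact eLpNorm_le_eLpNorm_of_exponent_le (by norm_num) g.integrable.aestronglyMeasurable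

theorem ae_mem : ∀ᵐ x ∂unitMeasure, x ∈ Icc (0 : ℝ) 1 :=
  ae_restrict_mem measurableSet_Icc

theorem L2.norm_primitive_le (g : L2) {x : ℝ} (hx : x ∈ Icc (0 : ℝ) 1) :
    ‖∫ t in (0 : ℝ)..x, g t‖ ≤ ‖g‖ := by
  refine (intervalIntegral.norm_integral_le_integral_norm hx.1).trans
    (le_trans ?_ g.integral_norm_le)
  rw [intervalIntegral.integral_of_le hx.1]
  exact setIntegral_mono_set g.integrable.norm
    (Filter.Eventually.of_forall fun _ => norm_nonneg _)
    (Filter.Eventually.of_forall fun t ht => ⟨ht.1.le, ht.2.trans hx.2⟩)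

theorem L2.continuousOn_primitive (g : L2) :
    ContinuousOn (fun x : ℝ => ∫ t in (0 : ℝ)..x, g t) (Icc 0 1) := by
  have h : IntegrableOn g (uIcc (0 : ℝ) 1) volume := by
    rw [uIcc_of_le zero_le_one]; exact g.integrable
  have := intervalIntegral.continuousOn_primitive_interval h
  rwa [uIcc_of_le zero_le_one] at this

theorem L2.primitive_add (g h : L2) {x : ℝ} (hx : x ∈ Icc (0 : ℝ) 1) :
    ∫ t in (0 : ℝ)..x, (g + h : L2) t =
      (∫ t in (0 : ℝ)..x, g t) + ∫ t in (0 : ℝ)..x, h t := by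
  have h0 : (0 : ℝ) ∈ Icc (0 : ℝ) 1 := by simp
  rw [← intervalIntegral.integral_add (g.intervalIntegrable h0 hx) (h.intervalIntegrable h0 hx),
    intervalIntegral.integral_of_le hx.1, intervalIntegral.integral_of_le hx.1]
  refine integral_congr_ae (ae_restrict_of_ae_restrict_of_subset (t := Icc (0 : ℝ) 1) ?_
    (Lp.coeFn_add g h))
  exact fun t ht => ⟨ht.1.le, ht.2.trans hx.2⟩

theorem L2.primitive_smul (a : ℂ) (g : L2) {x : ℝ} (hx : x ∈ Icc (0 : ℝ) 1) :
    ∫ t in (0 : ℝ)..x, (a • g : L2) t = a * ∫ t in (0 : ℝ)..x, g t := by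
  rw [← intervalIntegral.integral_const_mul,
    intervalIntegral.integral_of_le hx.1, intervalIntegral.integral_of_le hx.1]
  refine integral_congr_ae (ae_restrict_of_ae_restrict_of_subset (t := Icc (0 : ℝ) 1) ?_
    (Lp.coeFn_smul a g))
  exact fun t ht => ⟨ht.1.le, ht.2.trans hx.2⟩

/-- The Sobolev space `W₂¹[0,1]` of (classes of) absolutely continuous functions with derivative
in `L₂[0,1]`, as the space of pairs `(y, y')`.  The Hilbert norm that it inherits from
`L₂ ⊕ L₂` is `‖y‖² = ∫₀¹ (|y'|² + |y|²) dx`. -/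
def sobolev : Submodule ℂ (WithLp 2 (L2 × L2)) where
  carrier := {w | ∃ c : ℂ, ∀ᵐ x ∂unitMeasure, w.fst x = c + ∫ t in (0 : ℝ)..x, w.snd t}
  add_mem' := by
    rintro w z ⟨c, hc⟩ ⟨d, hd⟩
    refine ⟨c + d, ?_⟩
    filter_upwards [hc, hd, ae_mem, Lp.coeFn_add w.fst z.fst] with x h1 h2 hx h3
    rw [WithLp.add_fst, WithLp.add_snd, L2.primitive_add _ _ hx, h3, Pi.add_apply, h1, h2]
    ring
  zero_mem' := by
    refine ⟨0, ?_⟩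
    filter_upwards [ae_mem, Lp.coeFn_zero ℂ 2 unitMeasure] with x hx h
    have := L2.primitive_smul 0 0 hx
    rw [zero_smul, zero_mul] at this
    rw [WithLp.zero_fst, WithLp.zero_snd, this, h]
    simp
  smul_mem' := by
    rintro a w ⟨c, hc⟩
    refine ⟨a * c, ?_⟩
    filter_upwards [hc, ae_mem, Lp.coeFn_smul a w.fst] with x h1 hx h3
    rw [WithLp.smul_fst, WithLp.smul_snd, L2.primitive_smul _ _ hx, h3, Pi.smul_apply, h1]
    simp only [smul_eq_mul]
    ring

/-- The Hilbert space `W₂¹[0,1]` as a type. -/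
def W : Type := sobolev

instance : NormedAddCommGroup W := inferInstanceAs (NormedAddCommGroup sobolev)

instance : InnerProductSpace ℂ W := inferInstanceAs (InnerProductSpace ℂ sobolev)

/-- The isometric embedding `y ↦ (y, y')` of `W₂¹[0,1]` into `L₂ ⊕ L₂`. -/
def W.incl : W →ₗᵢ[ℂ] WithLp 2 (L2 × L2) := sobolev.subtypeₗᵢ

theorem W.coe_add (w z : W) : (w + z).1 = w.1 + z.1 := rfl

theorem W.coe_smul (a : ℂ) (w : W) : (a • w).1 = a • w.1 := rfl

theorem W.coe_sub (w z : W) : (w - z).1 = w.1 - z.1 := rfl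

/-- The derivative `y' ∈ L₂[0,1]` of `y ∈ W₂¹[0,1]`. -/
def W.deriv (w : W) : L2 := w.1.snd

/-- The initial value `y(0)` of the continuous representative. -/
def W.initial (w : W) : ℂ := w.2.choose

/-- The continuous representative of `y ∈ W₂¹[0,1]` (meaningful at `x ∈ [0,1]`). -/
def W.val (w : W) (x : ℝ) : ℂ := w.initial + ∫ t in (0 : ℝ)..x, w.deriv t

theorem W.val_ae (w : W) : ∀ᵐ x ∂unitMeasure, w.1.fst x = w.val x := w.2.choose_spec

theorem W.continuousOn_val (w : W) : ContinuousOn w.val (Icc 0 1) :=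
  continuousOn_const.add (L2.continuousOn_primitive _)

theorem W.initial_eq (w : W) {c : ℂ}
    (hc : ∀ᵐ x ∂unitMeasure, w.1.fst x = c + ∫ t in (0 : ℝ)..x, w.1.snd t) : w.initial = c := by
  obtain ⟨x, h1, h2⟩ := (hc.and w.val_ae).exists
  exact add_right_cancel (h2.symm.trans h1)

theorem W.initial_add (w z : W) : (w + z).initial = w.initial + z.initial := by
  refine W.initial_eq _ ?_
  filter_upwards [w.val_ae, z.val_ae, ae_mem, Lp.coeFn_add w.1.fst z.1.fst] with x h1 h2 hx h3
  rw [W.coe_add, WithLp.add_fst, WithLp.add_snd, L2.primitive_add _ _ hx, h3,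
    Pi.add_apply, h1, h2]
  simp only [W.val, W.deriv]
  ring

theorem W.initial_smul (a : ℂ) (w : W) : (a • w).initial = a * w.initial := by
  refine W.initial_eq _ ?_
  filter_upwards [w.val_ae, ae_mem, Lp.coeFn_smul a w.1.fst] with x h1 hx h3
  rw [W.coe_smul, WithLp.smul_fst, WithLp.smul_snd, L2.primitive_smul _ _ hx, h3,
    Pi.smul_apply, h1]
  simp only [W.val, W.deriv, smul_eq_mul]
  ring

theorem W.deriv_add (w z : W) : (w + z).deriv = w.deriv + z.deriv := rfl

theorem W.deriv_smul (a : ℂ) (w : W) : (a • w).deriv = a • w.deriv := rfl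

theorem W.val_add (w z : W) {x : ℝ} (hx : x ∈ Icc (0 : ℝ) 1) :
    (w + z).val x = w.val x + z.val x := by
  simp only [W.val, W.initial_add, W.deriv_add, L2.primitive_add _ _ hx]
  ring

theorem W.val_smul (a : ℂ) (w : W) {x : ℝ} (hx : x ∈ Icc (0 : ℝ) 1) :
    (a • w).val x = a * w.val x := by
  simp only [W.val, W.initial_smul, W.deriv_smul, L2.primitive_smul _ _ hx]
  ring

theorem W.norm_fst_le (w : W) : ‖w.1.fst‖ ≤ ‖w‖ := WithLp.norm_fst_le _ w.1

theorem W.norm_deriv_le (w : W) : ‖w.deriv‖ ≤ ‖w‖ := WithLp.norm_snd_le _ w.1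

theorem W.norm_initial_le (w : W) : ‖w.initial‖ ≤ 2 * ‖w‖ := by
  have h : ∀ᵐ x ∂unitMeasure, ‖w.initial‖ ≤ ‖w.1.fst x‖ + ‖w.deriv‖ := by
    filter_upwards [w.val_ae, ae_mem] with x h1 hx
    have : w.initial = w.1.fst x - ∫ t in (0 : ℝ)..x, w.deriv t := by
      rw [h1, W.val]; ring
    rw [this]
    exact (norm_sub_le _ _).trans (add_le_add le_rfl (w.deriv.norm_primitive_le hx))
  have := integral_mono_ae (integrable_const _)
    ((L2.integrable w.1.fst).norm.add (integrable_const _)) h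
  rw [integral_add' (L2.integrable w.1.fst).norm (integrable_const _)] at this
  simp only [integral_const, probReal_univ, one_smul] at this
  linarith [L2.integral_norm_le w.1.fst, w.norm_fst_le, w.norm_deriv_le]

theorem W.norm_val_le (w : W) {x : ℝ} (hx : x ∈ Icc (0 : ℝ) 1) : ‖w.val x‖ ≤ 3 * ‖w‖ := by
  have := norm_add_le w.initial (∫ t in (0 : ℝ)..x, w.deriv t)
  rw [W.val]
  linarith [w.norm_initial_le, w.norm_deriv_le, w.deriv.norm_primitive_le hx]

/-! Completeness of `W₂¹[0,1]`. -/

theorem L2.memLp_primitive (g : L2) :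
    MemLp (fun x : ℝ => ∫ t in (0 : ℝ)..x, g t) 2 unitMeasure := by
  refine MemLp.of_bound (g.continuousOn_primitive.aestronglyMeasurable measurableSet_Icc) ‖g‖ ?_
  filter_upwards [ae_mem] with x hx using g.norm_primitive_le hx

/-- The Volterra operator `g ↦ ∫₀ˣ g`. -/
def volterra : L2 →L[ℂ] L2 :=
  LinearMap.mkContinuous
    { toFun := fun g => g.memLp_primitive.toLp _
      map_add' := fun g h => by
        rw [← MemLp.toLp_add]
        refine MemLp.toLp_congr _ _ ?_
        filter_upwards [ae_mem] with x hx using L2.primitive_add g h hx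
      map_smul' := fun a g => by
        rw [RingHom.id_apply, ← MemLp.toLp_const_smul]
        refine MemLp.toLp_congr _ _ ?_
        filter_upwards [ae_mem] with x hx using L2.primitive_smul a g hx }
    1 (fun g => by
      have h := Lp.norm_le_of_ae_bound (f := g.memLp_primitive.toLp _) (norm_nonneg g) (by
        filter_upwards [ae_mem, g.memLp_primitive.coeFn_toLp] with x hx h
        rw [h]
        exact g.norm_primitive_le hx)
      have hμ : measureUnivNNReal unitMeasure = 1 := by
        simp [measureUnivNNReal]
      simpa [hμ] using h)

theorem volterra_ae (g : L2) : ∀ᵐ x ∂unitMeasure, volterra g x = ∫ t in (0 : ℝ)..x, g t :=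
  g.memLp_primitive.coeFn_toLp

theorem isClosed_sobolev : IsClosed (sobolev : Set (WithLp 2 (L2 × L2))) := by
  let one : L2 := (memLp_const (1 : ℂ)).toLp _
  have h1 : ∀ c : ℂ, ∀ᵐ x ∂unitMeasure, (c • one : L2) x = c := fun c => by
    filter_upwards [Lp.coeFn_smul c one, (memLp_const (1 : ℂ)).coeFn_toLp (p := 2)
      (μ := unitMeasure)] with x h h'
    rw [h, Pi.smul_apply, h']
    simp
  have h : (sobolev : Set (WithLp 2 (L2 × L2))) =
      (fun w : WithLp 2 (L2 × L2) => w.fst - volterra w.snd) ⁻¹'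
        (Submodule.span ℂ {one} : Set L2) := by
    ext w
    simp only [mem_preimage, SetLike.mem_coe, Submodule.mem_span_singleton]
    refine exists_congr fun c => ?_
    constructor
    · intro hc
      refine Lp.ext ?_
      filter_upwards [hc, h1 c, volterra_ae w.snd, Lp.coeFn_sub w.fst (volterra w.snd)]
        with x a b d e
      rw [b, e, Pi.sub_apply, a, d]; ring
    · intro hc
      filter_upwards [h1 c, volterra_ae w.snd, Lp.coeFn_sub w.fst (volterra w.snd)] with x b d e
      rw [hc, e, Pi.sub_apply, d] at b
      rw [← b]; ring
  rw [h]
  refine (Submodule.closed_of_finiteDimensional _).preimage ?_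
  exact (WithLp.prod_continuous_ofLp _ _ _).fst.sub
    (volterra.continuous.comp (WithLp.prod_continuous_ofLp _ _ _).snd)

instance : CompleteSpace W := isClosed_sobolev.completeSpace_coe

theorem W.eq_zero_of_fst_eq_zero (w : W) (h : w.1.fst = 0) : w = 0 := by
  have hz : ∀ᵐ x ∂unitMeasure, w.val x = 0 := by
    filter_upwards [w.val_ae, Lp.coeFn_zero ℂ 2 unitMeasure] with x h1 h2
    rw [← h1, h, h2]; rfl
  have hz' : EqOn w.val (fun _ => 0) (Icc 0 1) :=
    Measure.eqOn_Icc_of_ae_eq volume zero_ne_one hz w.continuousOn_val continuousOn_const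
  have hd := (w.deriv.intervalIntegrable (a := 0) (b := 1) (by simp) (by simp)).ae_hasDerivAt_integral
  have hw : w.deriv = 0 := by
    refine Lp.ext ?_
    have hI : ∀ᵐ x ∂unitMeasure, x ∈ Ioo (0 : ℝ) 1 := by
      rw [unitMeasure, Measure.restrict_congr_set Ioo_ae_eq_Icc.symm]
      exact ae_restrict_mem measurableSet_Ioo
    filter_upwards [hI, ae_restrict_of_ae hd, Lp.coeFn_zero ℂ 2 unitMeasure] with x hx h1 h2
    rw [h2]
    have h3 := h1 (by rw [uIcc_of_le zero_le_one]; exact ⟨hx.1.le, hx.2.le⟩) 0 (by simp)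
    have h4 : HasDerivAt (fun y => ∫ t in (0 : ℝ)..y, w.deriv t) 0 x := by
      refine (hasDerivAt_const x (-w.initial)).congr_of_eventuallyEq ?_
      filter_upwards [Icc_mem_nhds hx.1 hx.2] with y hy
      have := hz' hy
      rw [W.val] at this
      exact (neg_eq_of_add_eq_zero_right this).symm
    exact h3.unique h4
  exact Subtype.ext ((WithLp.ofLp_injective _) (Prod.ext h hw))

/-! The product `y z̄ ∈ W₂¹[0,1]` of `y, z ∈ W₂¹[0,1]`. -/

theorem integral_mul_integral {f g : ℝ → ℂ} {x : ℝ} (hx : 0 ≤ x)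
    (hf : IntegrableOn f (Ioc 0 x)) (hg : IntegrableOn g (Ioc 0 x)) :
    (∫ t in (0 : ℝ)..x, f t) * (∫ t in (0 : ℝ)..x, g t) =
      (∫ s in (0 : ℝ)..x, f s * ∫ t in (0 : ℝ)..s, g t) +
        ∫ s in (0 : ℝ)..x, (∫ t in (0 : ℝ)..s, f t) * g s := by
  set ν : Measure ℝ := volume.restrict (Ioc 0 x) with hν
  have hfg : Integrable (fun z : ℝ × ℝ => f z.1 * g z.2) (ν.prod ν) := hf.mul_prod hg
  have hS : MeasurableSet {z : ℝ × ℝ | z.2 ≤ z.1} := measurableSet_le measurable_snd measurable_fst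
  have hm : ∀ᵐ s ∂ν, s ∈ Ioc 0 x := ae_restrict_mem measurableSet_Ioc
  have key : ∀ (h : ℝ → ℂ) (s : ℝ), s ∈ Ioc 0 x →
      ∫ t in Iic s, h t ∂ν = ∫ t in (0 : ℝ)..s, h t := by
    intro h s hs
    rw [intervalIntegral.integral_of_le hs.1.le, hν, Measure.restrict_restrict measurableSet_Iic]
    congr 2
    ext t
    simp only [mem_inter_iff, mem_Iic, mem_Ioc]
    exact ⟨fun h => ⟨h.2.1, h.1⟩, fun h => ⟨h.2, h.1, h.2.trans hs.2⟩⟩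
  have hA : ∫ z in {z : ℝ × ℝ | z.2 ≤ z.1}, f z.1 * g z.2 ∂(ν.prod ν) =
      ∫ s, f s * (∫ t in (0 : ℝ)..s, g t) ∂ν := by
    rw [← integral_indicator hS, integral_prod _ (hfg.indicator hS)]
    refine integral_congr_ae ?_
    filter_upwards [hm] with s hs
    rw [← key g s hs, ← integral_const_mul, ← integral_indicator measurableSet_Iic]
    rfl
  have hB : ∫ z in {z : ℝ × ℝ | z.2 ≤ z.1}ᶜ, f z.1 * g z.2 ∂(ν.prod ν) =
      ∫ s, (∫ t in (0 : ℝ)..s, f t) * g s ∂ν := by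
    rw [← integral_indicator hS.compl, integral_prod_symm _ (hfg.indicator hS.compl)]
    refine integral_congr_ae ?_
    filter_upwards [hm] with s hs
    have hae : (Iic s : Set ℝ) =ᵐ[ν] Iio s := Iio_ae_eq_Iic.symm
    rw [← key f s hs, ← integral_mul_const, setIntegral_congr_set hae,
      ← integral_indicator measurableSet_Iio]
    refine integral_congr_ae (Filter.Eventually.of_forall fun t => ?_)
    simp [indicator, not_le]
  rw [intervalIntegral.integral_of_le hx, intervalIntegral.integral_of_le hx,
    intervalIntegral.integral_of_le hx, intervalIntegral.integral_of_le hx, ← hν]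
  exact (integral_prod_mul f g).symm.trans
    ((integral_add_compl hS hfg).symm.trans (congrArg₂ _ hA hB))

theorem L2.memLp_mul (g : L2) {u : ℝ → ℂ} (hu : ContinuousOn u (Icc 0 1)) :
    MemLp (fun x => u x * g x) 2 unitMeasure := by
  obtain ⟨C, hC⟩ := isCompact_Icc.exists_bound_of_continuousOn hu
  refine (Lp.memLp g).of_le_mul (c := C)
    ((hu.aestronglyMeasurable measurableSet_Icc).mul (Lp.memLp g).aestronglyMeasurable) ?_
  filter_upwards [ae_mem] with x hx
  rw [norm_mul]
  exact mul_le_mul_of_nonneg_right (hC x hx) (norm_nonneg _)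

theorem W.continuousOn_conj_val (z : W) : ContinuousOn (fun x => conj (z.val x)) (Icc 0 1) :=
  Complex.continuous_conj.comp_continuousOn z.continuousOn_val

theorem L2.memLp_conj (g : L2) : MemLp (fun x => conj (g x)) 2 unitMeasure := (Lp.memLp g).star

/-- The conjugate of an element of `L₂[0,1]`. -/
def L2.conj (g : L2) : L2 := g.memLp_conj.toLp _

/-- The product of an element of `L₂[0,1]` by a function continuous on `[0,1]`. -/
def L2.cmul (u : ℝ → ℂ) (hu : ContinuousOn u (Icc 0 1)) (g : L2) : L2 := (g.memLp_mul hu).toLp _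

theorem L2.conj_ae (g : L2) : ∀ᵐ x ∂unitMeasure, g.conj x = starRingEnd ℂ (g x) :=
  g.memLp_conj.coeFn_toLp

theorem L2.cmul_ae (u : ℝ → ℂ) (hu : ContinuousOn u (Icc 0 1)) (g : L2) :
    ∀ᵐ x ∂unitMeasure, L2.cmul u hu g x = u x * g x := (g.memLp_mul hu).coeFn_toLp

theorem L2.norm_conj_le (g : L2) : ‖g.conj‖ ≤ ‖g‖ := by
  refine Lp.norm_le_norm_of_ae_le ?_
  filter_upwards [g.conj_ae] with x hx
  rw [hx, RCLike.norm_conj]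

theorem L2.norm_cmul_le {u : ℝ → ℂ} (hu : ContinuousOn u (Icc 0 1)) (g : L2) {C : ℝ}
    (hC : ∀ x ∈ Icc (0 : ℝ) 1, ‖u x‖ ≤ C) : ‖L2.cmul u hu g‖ ≤ C * ‖g‖ := by
  refine Lp.norm_le_mul_norm_of_ae_le_mul ?_
  filter_upwards [L2.cmul_ae u hu g, ae_mem] with x hx hx'
  rw [hx, norm_mul]
  exact mul_le_mul_of_nonneg_right (hC x hx') (norm_nonneg _)

theorem ae_interval {P : ℝ → Prop} (h : ∀ᵐ x ∂unitMeasure, P x) {x : ℝ}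
    (hx : x ∈ Icc (0 : ℝ) 1) : ∀ᵐ t ∂volume.restrict (Ioc 0 x), P t :=
  ae_restrict_of_ae_restrict_of_subset (t := Icc (0 : ℝ) 1)
    (fun _ ht => ⟨ht.1.le, ht.2.trans hx.2⟩) h

theorem L2.integrableOn (g : L2) {x : ℝ} (hx : x ∈ Icc (0 : ℝ) 1) : IntegrableOn g (Ioc 0 x) :=
  IntegrableOn.mono_set (t := Icc (0 : ℝ) 1) g.integrable
    (fun _ ht => ⟨ht.1.le, ht.2.trans hx.2⟩)

theorem L2.primitive_conj (g : L2) {x : ℝ} (hx : x ∈ Icc (0 : ℝ) 1) :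
    ∫ t in (0 : ℝ)..x, g.conj t = starRingEnd ℂ (∫ t in (0 : ℝ)..x, g t) := by
  rw [intervalIntegral.integral_of_le hx.1, intervalIntegral.integral_of_le hx.1, ← integral_conj]
  exact integral_congr_ae (ae_interval g.conj_ae hx)

/-- The derivative `y' z̄ + y z̄'` of `y z̄`. -/
def W.derivMulConj (y z : W) : L2 :=
  L2.cmul _ z.continuousOn_conj_val y.deriv + L2.cmul _ y.continuousOn_val z.deriv.conj

theorem W.val_mul_conj (y z : W) {x : ℝ} (hx : x ∈ Icc (0 : ℝ) 1) :
    y.val x * conj (z.val x) =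
      y.initial * conj z.initial + ∫ t in (0 : ℝ)..x, y.derivMulConj z t := by
  have h0 : (0 : ℝ) ∈ Icc (0 : ℝ) 1 := by simp
  have e1 : ∫ t in (0 : ℝ)..x, y.derivMulConj z t =
      ∫ t in (0 : ℝ)..x, ((conj z.initial * y.deriv t + y.initial * z.deriv.conj t) +
        (y.deriv t * (∫ s in (0 : ℝ)..t, z.deriv.conj s) +
          (∫ s in (0 : ℝ)..t, y.deriv s) * z.deriv.conj t)) := by
    rw [intervalIntegral.integral_of_le hx.1, intervalIntegral.integral_of_le hx.1]
    refine integral_congr_ae (ae_interval (x := x) ?_ hx)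
    filter_upwards [Lp.coeFn_add (L2.cmul _ z.continuousOn_conj_val y.deriv)
      (L2.cmul _ y.continuousOn_val z.deriv.conj), L2.cmul_ae _ z.continuousOn_conj_val y.deriv,
      L2.cmul_ae _ y.continuousOn_val z.deriv.conj, ae_mem] with t h1 h2 h3 ht
    rw [W.derivMulConj, h1, Pi.add_apply, h2, h3, L2.primitive_conj _ ht, W.val, W.val, map_add]
    ring
  have i1 := (y.deriv.intervalIntegrable h0 hx).const_mul (conj z.initial)
  have i2 := (z.deriv.conj.intervalIntegrable h0 hx).const_mul y.initial
  have i3 : IntervalIntegrable (fun t => y.deriv t * ∫ s in (0 : ℝ)..t, z.deriv.conj s)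
      volume 0 x := by
    refine (y.deriv.intervalIntegrable h0 hx).mul_continuousOn ?_
    exact z.deriv.conj.continuousOn_primitive.mono (uIcc_subset_Icc h0 hx)
  have i4 : IntervalIntegrable (fun t => (∫ s in (0 : ℝ)..t, y.deriv s) * z.deriv.conj t)
      volume 0 x := by
    refine (z.deriv.conj.intervalIntegrable h0 hx).continuousOn_mul ?_
    exact y.deriv.continuousOn_primitive.mono (uIcc_subset_Icc h0 hx)
  rw [e1, intervalIntegral.integral_add (i1.add i2) (i3.add i4),
    intervalIntegral.integral_add i1 i2, intervalIntegral.integral_add i3 i4,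
    ← integral_mul_integral hx.1 (y.deriv.integrableOn hx) (z.deriv.conj.integrableOn hx),
    intervalIntegral.integral_const_mul, intervalIntegral.integral_const_mul,
    L2.primitive_conj _ hx, W.val, W.val, map_add]
  ring

theorem W.memLp_val (w : W) : MemLp w.val 2 unitMeasure := by
  refine MemLp.of_bound (w.continuousOn_val.aestronglyMeasurable measurableSet_Icc) (3 * ‖w‖) ?_
  filter_upwards [ae_mem] with x hx using w.norm_val_le hx

/-- The element `y z̄` of `W₂¹[0,1]`, for `y, z ∈ W₂¹[0,1]`. -/
def W.mulConj (y z : W) : W :=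
  ⟨WithLp.toLp 2 (L2.cmul _ y.continuousOn_val (L2.conj z.1.fst), y.derivMulConj z),
    y.initial * conj z.initial, by
      filter_upwards [L2.cmul_ae _ y.continuousOn_val (L2.conj z.1.fst), L2.conj_ae z.1.fst,
        z.val_ae, ae_mem] with x h1 h2 h3 hx
      change L2.cmul _ y.continuousOn_val (L2.conj z.1.fst) x = _
      rw [h1, h2, h3, W.val_mul_conj y z hx]
      rfl⟩

theorem W.val_mulConj (y z : W) {x : ℝ} (hx : x ∈ Icc (0 : ℝ) 1) :
    (y.mulConj z).val x = y.val x * conj (z.val x) := by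
  have h : (y.mulConj z).initial = y.initial * conj z.initial := by
    refine W.initial_eq _ ?_
    filter_upwards [L2.cmul_ae _ y.continuousOn_val (L2.conj z.1.fst), L2.conj_ae z.1.fst,
        z.val_ae, ae_mem] with x h1 h2 h3 hx
    change L2.cmul _ y.continuousOn_val (L2.conj z.1.fst) x = _
    rw [h1, h2, h3, W.val_mul_conj y z hx]
    rfl
  rw [W.val_mul_conj y z hx, W.val, h]
  rfl

theorem W.ext_val {w z : W} (h : ∀ x ∈ Icc (0 : ℝ) 1, w.val x = z.val x) : w = z := by
  have hf : w.1.fst = z.1.fst := by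
    refine Lp.ext ?_
    filter_upwards [w.val_ae, z.val_ae, ae_mem] with x h1 h2 hx
    rw [h1, h2, h x hx]
  refine sub_eq_zero.1 (W.eq_zero_of_fst_eq_zero _ ?_)
  rw [W.coe_sub, WithLp.sub_fst, hf, sub_self]

theorem W.norm_mulConj_le (y z : W) : ‖y.mulConj z‖ ≤ 9 * ‖y‖ * ‖z‖ := by
  have h1 : ‖(y.mulConj z).1.fst‖ ≤ 3 * ‖y‖ * ‖z‖ := by
    refine (L2.norm_cmul_le y.continuousOn_val _ fun x hx => y.norm_val_le hx).trans ?_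
    exact mul_le_mul_of_nonneg_left ((L2.norm_conj_le _).trans z.norm_fst_le) (by positivity)
  have h2 : ‖(y.mulConj z).1.snd‖ ≤ 3 * ‖z‖ * ‖y‖ + 3 * ‖y‖ * ‖z‖ := by
    refine (norm_add_le _ _).trans (add_le_add ?_ ?_)
    · refine (L2.norm_cmul_le z.continuousOn_conj_val _ (C := 3 * ‖z‖) fun x hx => ?_).trans ?_
      · rw [RCLike.norm_conj]; exact z.norm_val_le hx
      · exact mul_le_mul_of_nonneg_left y.norm_deriv_le (by positivity)
    · refine (L2.norm_cmul_le y.continuousOn_val _ fun x hx => y.norm_val_le hx).trans ?_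
      exact mul_le_mul_of_nonneg_left ((L2.norm_conj_le _).trans z.norm_deriv_le) (by positivity)
  have h3 : ‖y.mulConj z‖ ≤ ‖(y.mulConj z).1.fst‖ + ‖(y.mulConj z).1.snd‖ := by
    have h4 : ‖y.mulConj z‖ ^ 2 = ‖(y.mulConj z).1.fst‖ ^ 2 + ‖(y.mulConj z).1.snd‖ ^ 2 :=
      WithLp.prod_norm_sq_eq_of_L2 (y.mulConj z).1
    refine abs_le_of_sq_le_sq' ?_ (by positivity) |>.2
    nlinarith [mul_nonneg (norm_nonneg (y.mulConj z).1.fst) (norm_nonneg (y.mulConj z).1.snd)]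
  linarith

/-! The operator pencil. -/

/-- The vector `y^∧ = (y(0), y(1))`. -/
def trace : W →L[ℂ] (Fin 2 → ℂ) :=
  LinearMap.mkContinuous
    { toFun := fun y => ![y.val 0, y.val 1]
      map_add' := fun y z => by simp [W.val_add]
      map_smul' := fun a y => by simp [W.val_smul] }
    3 (fun y => by
      refine (pi_norm_le_iff_of_nonneg (by positivity)).2 fun i => ?_
      fin_cases i
      · exact y.norm_val_le (by simp)
      · exact y.norm_val_le (by simp))

/-- The space `ℌ_U = {y ∈ W₂¹[0,1] | y^∧ ∈ im (U - 1)}`. -/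
def HU (U : Matrix (Fin 2) (Fin 2) ℂ) : Submodule ℂ W :=
  (LinearMap.range (U - 1).mulVecLin).comap trace.toLinearMap

theorem isClosed_HU (U : Matrix (Fin 2) (Fin 2) ℂ) : IsClosed (HU U : Set W) :=
  (Submodule.closed_of_finiteDimensional (LinearMap.range (U - 1).mulVecLin)).preimage
    trace.continuous

instance (U : Matrix (Fin 2) (Fin 2) ℂ) : CompleteSpace (HU U) := (isClosed_HU U).completeSpace_coe

/-- The embedding `I : ℌ_U → L₂[0,1]`. -/
def embed (U : Matrix (Fin 2) (Fin 2) ℂ) : HU U →L[ℂ] L2 :=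
  (WithLp.fstL 2 ℂ L2 L2 ∘L W.incl.toContinuousLinearMap) ∘L (HU U).subtypeL

/-- `L₂[0,1]` with the norm `‖I* f‖`. -/
def PreNeg (_U : Matrix (Fin 2) (Fin 2) ℂ) : Type := L2

instance (U : Matrix (Fin 2) (Fin 2) ℂ) : AddCommGroup (PreNeg U) :=
  inferInstanceAs (AddCommGroup L2)

instance (U : Matrix (Fin 2) (Fin 2) ℂ) : Module ℂ (PreNeg U) :=
  inferInstanceAs (Module ℂ L2)

/-- The operator `I* : L₂[0,1] → ℌ_U`. -/
def adj (U : Matrix (Fin 2) (Fin 2) ℂ) : PreNeg U →ₗ[ℂ] HU U :=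
  (ContinuousLinearMap.adjoint (embed U)).toLinearMap

instance (U : Matrix (Fin 2) (Fin 2) ℂ) : SeminormedAddCommGroup (PreNeg U) :=
  SeminormedAddCommGroup.induced (PreNeg U) (HU U) (adj U)

instance (U : Matrix (Fin 2) (Fin 2) ℂ) : NormedSpace ℂ (PreNeg U) :=
  NormedSpace.induced ℂ (PreNeg U) (HU U) (adj U)

/-- The space `ℌ'_U`, the completion of `L₂[0,1]` with respect to the norm `‖I* f‖`. -/
abbrev HNeg (U : Matrix (Fin 2) (Fin 2) ℂ) : Type := UniformSpace.Completion (PreNeg U)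

/-- `I*` as an isometry for the norm `‖I* f‖`. -/
def adjIsometry (U : Matrix (Fin 2) (Fin 2) ℂ) : PreNeg U →ₗᵢ[ℂ] HU U := ⟨adj U, fun _ => rfl⟩

theorem embed_injective (U : Matrix (Fin 2) (Fin 2) ℂ) : Function.Injective (embed U) := by
  refine (injective_iff_map_eq_zero _).2 fun y hy => ?_
  exact Subtype.ext (W.eq_zero_of_fst_eq_zero _ hy)

theorem denseRange_adjIsometry (U : Matrix (Fin 2) (Fin 2) ℂ) :
    DenseRange (adjIsometry U) := by
  have h : (ContinuousLinearMap.adjoint (embed U)).rangeᗮ = ⊥ := by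
    rw [ContinuousLinearMap.orthogonal_range, ContinuousLinearMap.adjoint_adjoint]
    exact LinearMap.ker_eq_bot.2 (embed_injective U)
  have h2 := (Submodule.topologicalClosure_eq_top_iff).2 h
  intro y
  have : y ∈ (ContinuousLinearMap.adjoint (embed U)).range.topologicalClosure := by
    rw [h2]; trivial
  exact this

/-- The continuous extension of `I*` to `ℌ'_U`. -/
def extAdj (U : Matrix (Fin 2) (Fin 2) ℂ) : HNeg U →L[ℂ] HU U :=
  (adjIsometry U).toContinuousLinearMap.extend
    (UniformSpace.Completion.toComplL : PreNeg U →L[ℂ] HNeg U)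

theorem extAdj_coe (U : Matrix (Fin 2) (Fin 2) ℂ) (f : PreNeg U) :
    extAdj U (f : HNeg U) = adjIsometry U f :=
  ContinuousLinearMap.extend_eq (e := (UniformSpace.Completion.toComplL : PreNeg U →L[ℂ] HNeg U)) _
    UniformSpace.Completion.denseRange_coe (UniformSpace.Completion.isUniformInducing_coe _) f

theorem norm_extAdj (U : Matrix (Fin 2) (Fin 2) ℂ) (f : HNeg U) : ‖extAdj U f‖ = ‖f‖ := by
  refine UniformSpace.Completion.induction_on f
    (isClosed_eq (extAdj U).continuous.norm continuous_norm) fun g => ?_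
  rw [extAdj_coe, LinearIsometry.norm_map, UniformSpace.Completion.norm_coe]

/-- `I⁺` as a linear isometry. -/
def plusIsometry (U : Matrix (Fin 2) (Fin 2) ℂ) : HNeg U →ₗᵢ[ℂ] HU U :=
  ⟨(extAdj U).toLinearMap, norm_extAdj U⟩

theorem plusIsometry_surjective (U : Matrix (Fin 2) (Fin 2) ℂ) :
    Function.Surjective (plusIsometry U) := by
  have h1 : IsClosed (range (plusIsometry U)) :=
    (plusIsometry U).isometry.isClosedEmbedding.isClosed_range
  have h2 : range (adjIsometry U) ⊆ range (plusIsometry U) := by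
    rintro _ ⟨f, rfl⟩
    exact ⟨f, extAdj_coe U f⟩
  exact range_eq_univ.1 (h1.closure_eq ▸ ((denseRange_adjIsometry U).mono h2).closure_eq)

/-- The isometry `I⁺ : ℌ'_U → ℌ_U` that extends `I*`; it is onto because `I` is injective. -/
def Iplus (U : Matrix (Fin 2) (Fin 2) ℂ) : HNeg U ≃ₗᵢ[ℂ] HU U :=
  LinearIsometryEquiv.ofSurjective (plusIsometry U) (plusIsometry_surjective U)

/-- The space `W₂⁻¹[0,1]`: bounded linear functionals `y ↦ ∫₀¹ q y dx` on `W₂¹[0,1]`. -/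
abbrev WNeg : Type := W →L[ℂ] ℂ

/-- An element of `W₂⁻¹[0,1]` is real if it is real on real functions. -/
def WNeg.IsReal (q : WNeg) : Prop :=
  ∀ y : W, (∀ x ∈ Icc (0 : ℝ) 1, (y.val x).im = 0) → (q y).im = 0

/-- The diagonal matrix `V` with `V_kk = -cot (arg U_kk / 2)` if `U_kk ≠ 1`, and `0` otherwise. -/
def boundaryMatrix (U : Matrix (Fin 2) (Fin 2) ℂ) : Matrix (Fin 2) (Fin 2) ℂ :=
  open scoped Classical in
  Matrix.diagonal fun k => if U k k = 1 then 0 else ((-Real.cot (Complex.arg (U k k) / 2) : ℝ) : ℂ)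

/-- The sesquilinear form (linear in `y`, antilinear in `z`)
`∫ p y' z̄' dx + ∫ (q - λ r) y z̄ dx + ⟨V y^∧, z^∧⟩`. -/
def form (p : Lp ℝ ∞ unitMeasure) (q r : WNeg) (U : Matrix (Fin 2) (Fin 2) ℂ) (lam : ℂ)
    (y z : W) : ℂ :=
  (∫ x, (p x : ℂ) * y.deriv x * conj (z.deriv x) ∂unitMeasure) +
    (q - lam • r) (y.mulConj z) + (boundaryMatrix U).mulVec (trace y) ⬝ᵥ star (trace z)

theorem integral_eq_inner (p : Lp ℝ ∞ unitMeasure) (f g : L2) :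
    ∫ x, (p x : ℂ) * f x * conj (g x) ∂unitMeasure = inner ℂ g (p • f : L2) := by
  rw [L2.inner_def]
  refine integral_congr_ae ?_
  filter_upwards [Lp.coeFn_lpSMul (r := 2) p f] with x hx
  rw [hx]
  simp [RCLike.inner_apply]

theorem form_add_left (p : Lp ℝ ∞ unitMeasure) (q r : WNeg) (U : Matrix (Fin 2) (Fin 2) ℂ)
    (lam : ℂ) (y₁ y₂ z : W) :
    form p q r U lam (y₁ + y₂) z = form p q r U lam y₁ z + form p q r U lam y₂ z := by
  have h : (y₁ + y₂).mulConj z = y₁.mulConj z + y₂.mulConj z := W.ext_val fun x hx => by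
    rw [W.val_add _ _ hx, W.val_mulConj _ _ hx, W.val_mulConj _ _ hx, W.val_mulConj _ _ hx,
      W.val_add _ _ hx, add_mul]
  simp only [form, integral_eq_inner, W.deriv_add, Lp.add_smul, inner_add_right, h, map_add,
    Matrix.mulVec_add, add_dotProduct]
  ring

theorem form_smul_left (p : Lp ℝ ∞ unitMeasure) (q r : WNeg) (U : Matrix (Fin 2) (Fin 2) ℂ)
    (lam a : ℂ) (y z : W) :
    form p q r U lam (a • y) z = a * form p q r U lam y z := by
  have h : (a • y).mulConj z = a • y.mulConj z := W.ext_val fun x hx => by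
    rw [W.val_smul _ _ hx, W.val_mulConj _ _ hx, W.val_mulConj _ _ hx, W.val_smul _ _ hx,
      mul_assoc]
  have h2 : (p • (a • y.deriv : L2) : L2) = (a • (p • y.deriv : L2) : L2) := by
    refine Lp.ext ?_
    filter_upwards [Lp.coeFn_lpSMul (r := 2) p (a • y.deriv), Lp.coeFn_smul a y.deriv,
      Lp.coeFn_lpSMul (r := 2) p y.deriv, Lp.coeFn_smul a (p • y.deriv : L2)] with x h1 h2 h3 h4
    rw [h1, h4, Pi.smul_apply', h2, Pi.smul_apply, Pi.smul_apply, h3, Pi.smul_apply',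
      smul_comm]
  simp only [form, integral_eq_inner, W.deriv_smul, h2, inner_smul_right, h, map_smul,
    Matrix.mulVec_smul, smul_dotProduct, smul_eq_mul]
  ring

theorem form_add_right (p : Lp ℝ ∞ unitMeasure) (q r : WNeg) (U : Matrix (Fin 2) (Fin 2) ℂ)
    (lam : ℂ) (y z₁ z₂ : W) :
    form p q r U lam y (z₁ + z₂) = form p q r U lam y z₁ + form p q r U lam y z₂ := by
  have h : y.mulConj (z₁ + z₂) = y.mulConj z₁ + y.mulConj z₂ := W.ext_val fun x hx => by
    rw [W.val_add _ _ hx, W.val_mulConj _ _ hx, W.val_mulConj _ _ hx, W.val_mulConj _ _ hx,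
      W.val_add _ _ hx, map_add, mul_add]
  simp only [form, integral_eq_inner, W.deriv_add, inner_add_left, h, map_add, star_add,
    dotProduct_add]
  ring

theorem form_smul_right (p : Lp ℝ ∞ unitMeasure) (q r : WNeg) (U : Matrix (Fin 2) (Fin 2) ℂ)
    (lam a : ℂ) (y z : W) :
    form p q r U lam y (a • z) = conj a * form p q r U lam y z := by
  have h : y.mulConj (a • z) = conj a • y.mulConj z := W.ext_val fun x hx => by
    rw [W.val_smul _ _ hx, W.val_mulConj _ _ hx, W.val_mulConj _ _ hx, W.val_smul _ _ hx,
      map_mul]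
    ring
  simp only [form, integral_eq_inner, W.deriv_smul, inner_smul_left, h, map_smul, star_smul,
    dotProduct_smul, smul_eq_mul, RCLike.star_def]
  ring

theorem norm_trace_apply_le (y : W) (i : Fin 2) : ‖trace y i‖ ≤ 3 * ‖y‖ := by
  fin_cases i
  · exact y.norm_val_le (by simp)
  · exact y.norm_val_le (by simp)

theorem form_bound (p : Lp ℝ ∞ unitMeasure) (q r : WNeg) (U : Matrix (Fin 2) (Fin 2) ℂ)
    (lam : ℂ) : ∃ C : ℝ, ∀ y z : W, ‖form p q r U lam y z‖ ≤ C * ‖y‖ * ‖z‖ := by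
  let v : Fin 2 → ℂ := fun i => boundaryMatrix U i i
  refine ⟨‖p‖ + ‖q - lam • r‖ * 9 + 9 * (‖v 0‖ + ‖v 1‖), fun y z => ?_⟩
  have h1 : ‖inner ℂ z.deriv (p • y.deriv : L2)‖ ≤ ‖p‖ * ‖y‖ * ‖z‖ := by
    refine (norm_inner_le_norm _ _).trans ?_
    have := Lp.norm_smul_le (r := 2) p y.deriv
    calc ‖z.deriv‖ * ‖(p • y.deriv : L2)‖ ≤ ‖z‖ * (‖p‖ * ‖y‖) :=
          mul_le_mul z.norm_deriv_le
            (this.trans (mul_le_mul_of_nonneg_left y.norm_deriv_le (norm_nonneg _)))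
            (norm_nonneg _) (norm_nonneg _)
      _ = _ := by ring
  have h2 : ‖(q - lam • r) (y.mulConj z)‖ ≤ ‖q - lam • r‖ * 9 * ‖y‖ * ‖z‖ := by
    refine (ContinuousLinearMap.le_opNorm _ _).trans ?_
    calc _ ≤ ‖q - lam • r‖ * (9 * ‖y‖ * ‖z‖) :=
          mul_le_mul_of_nonneg_left (y.norm_mulConj_le z) (norm_nonneg _)
      _ = _ := by ring
  have h3 : ∀ i, ‖v i * trace y i * conj (trace z i)‖ ≤ 9 * ‖v i‖ * ‖y‖ * ‖z‖ := fun i => by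
    rw [norm_mul, norm_mul, RCLike.norm_conj]
    calc _ ≤ ‖v i‖ * (3 * ‖y‖) * (3 * ‖z‖) := by
          gcongr
          · exact norm_trace_apply_le y i
          · exact norm_trace_apply_le z i
      _ = _ := by ring
  have h4 : (boundaryMatrix U).mulVec (trace y) ⬝ᵥ star (trace z) =
      v 0 * trace y 0 * conj (trace z 0) + v 1 * trace y 1 * conj (trace z 1) := by
    simp [boundaryMatrix, Matrix.mulVec_diagonal, dotProduct, Fin.sum_univ_two, v]
  rw [form, integral_eq_inner, h4]
  refine (norm_add₃_le).trans ?_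
  have h5 := norm_add_le (v 0 * trace y 0 * conj (trace z 0)) (v 1 * trace y 1 * conj (trace z 1))
  have h6 := h3 0
  have h7 := h3 1
  linarith

/-- The form as a bounded sesquilinear form on `ℌ_U`, antilinear argument first. -/
def boundedForm (p : Lp ℝ ∞ unitMeasure) (q r : WNeg) (U : Matrix (Fin 2) (Fin 2) ℂ)
    (lam : ℂ) : HU U →L⋆[ℂ] HU U →L[ℂ] ℂ :=
  LinearMap.mkContinuous₂
    (LinearMap.mk₂'ₛₗ (starRingEnd ℂ) (RingHom.id ℂ)
      (fun z y : HU U => form p q r U lam (y : W) (z : W))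
      (fun z₁ z₂ y => form_add_right p q r U lam y z₁ z₂)
      (fun a z y => form_smul_right p q r U lam a y z)
      (fun z y₁ y₂ => form_add_left p q r U lam y₁ y₂ z)
      (fun a z y => form_smul_left p q r U lam a y z))
    (form_bound p q r U lam).choose
    (fun z y => by
      have := (form_bound p q r U lam).choose_spec (y : W) (z : W)
      rw [mul_right_comm] at this
      exact this)

/-- The linear operator pencil `T : ℌ_U → ℌ'_U`, determined by
`⟨I⁺ T(λ) y, z⟩ = ∫ p y' z̄' dx + ∫ (q - λ r) y z̄ dx + ⟨V y^∧, z^∧⟩`. -/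
def pencil (p : Lp ℝ ∞ unitMeasure) (q r : WNeg) (U : Matrix (Fin 2) (Fin 2) ℂ)
    (lam : ℂ) : HU U →L[ℂ] HNeg U :=
  (Iplus U).symm.toContinuousLinearEquiv.toContinuousLinearMap ∘L
    ContinuousLinearMap.adjoint
      (InnerProductSpace.continuousLinearMapOfBilin (boundedForm p q r U lam))

/-- The operator `I⁺ T(λ)` on `ℌ_U`. -/
def plusPencil (p : Lp ℝ ∞ unitMeasure) (q r : WNeg) (U : Matrix (Fin 2) (Fin 2) ℂ)
    (lam : ℂ) : HU U →L[ℂ] HU U :=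
  (Iplus U).toContinuousLinearEquiv.toContinuousLinearMap ∘L pencil p q r U lam

/-- The identity that determines the pencil (Mathlib's inner product is antilinear in its first
argument). -/
theorem inner_plusPencil (p : Lp ℝ ∞ unitMeasure) (q r : WNeg) (U : Matrix (Fin 2) (Fin 2) ℂ)
    (lam : ℂ) (y z : HU U) :
    inner ℂ z (plusPencil p q r U lam y) = form p q r U lam (y : W) (z : W) := by
  have h : plusPencil p q r U lam y = ContinuousLinearMap.adjoint
      (InnerProductSpace.continuousLinearMapOfBilin (boundedForm p q r U lam)) y :=
    (Iplus U).apply_symm_apply _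
  rw [h, ContinuousLinearMap.adjoint_inner_right,
    InnerProductSpace.continuousLinearMapOfBilin_apply]
  rfl

/-- The index of inertia of a quadratic form `m` on a Hilbert space: the supremum of the dimensions
of the subspaces on which `m[y] ≤ -c ‖y‖²` for some `c > 0`. -/
def formIndex {E : Type*} [NormedAddCommGroup E] [InnerProductSpace ℂ E] (m : E → ℝ) : ℕ∞ :=
  ⨆ (M : Submodule ℂ E) (_ : ∃ c : ℝ, 0 < c ∧ ∀ y ∈ M, m y ≤ -c * ‖y‖ ^ 2),
    Cardinal.toENat (Module.rank ℂ M)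

/-- The index of inertia of a Hermitian operator `A`, i.e. of the form `⟨A y, y⟩`. -/
def operatorIndex {E : Type*} [NormedAddCommGroup E] [InnerProductSpace ℂ E] (A : E →L[ℂ] E) :
    ℕ∞ :=
  formIndex A.reApplyInnerSelf

end SturmLiouville

end

/-
Let `y` be an eigenfunction, `u` its quasi-derivative, so that `y` and `u` solve a linear first
order system, and let `A = I⁺ T(λ)`. By unique continuation `y` and `u` have no common zero.

For the lower bound, cut `y` at `n` interior zeros into `n + 1` pieces extended by zero. The form of
`A` vanishes on their span, and on the span of `n` of them `A` is injective: a solution vanishing on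
the omitted piece vanishes identically. Moving a null vector `w` to `w - ε A w` lowers the form by
`2 ε ‖A w‖²` up to terms of order `ε²`, so a small `ε` gives a subspace of dimension `n` on which
the form is negative definite.

For the upper bound it suffices that the form is nonnegative at each `z` vanishing at the zeros
of `y`. Picone's identity writes its density as `((u / y) |z|²)' + p |z' - (y' / y) z|²`. At a zero
of `y` the boundary term `(u / y) |z|²` tends to `0`, because `|y|` decays only linearly there while
`|z|² = o(|x - x₀|)`; at `0` and `1` it is offset by the boundary part of the form.
-/

noncomputable section

namespace SturmLiouville

section IndexOfInertia

variable {E : Type*} [NormedAddCommGroup E] [InnerProductSpace ℂ E]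

theorem formIndex_le_finrank {F : Type*} [AddCommGroup F] [Module ℂ F] [FiniteDimensional ℂ F]
    {m : E → ℝ} (l : E →ₗ[ℂ] F) (h : ∀ z, l z = 0 → 0 ≤ m z) :
    formIndex m ≤ Module.finrank ℂ F := by
  refine iSup₂_le fun M ⟨c, hc, hM⟩ => ?_
  have hinj : Function.Injective (l.domRestrict M) := by
    refine (injective_iff_map_eq_zero _).2 fun z hz => ?_
    have hneg : 0 ≤ -c * ‖(z : E)‖ ^ 2 := (h _ hz).trans (hM _ z.2)
    have hzero : ‖(z : E)‖ ^ 2 ≤ 0 := by nlinarith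
    simpa using hzero
  have := FiniteDimensional.of_injective _ hinj
  rw [← Module.finrank_eq_rank, Cardinal.toENat_nat]
  exact_mod_cast LinearMap.finrank_le_finrank_of_injective hinj

theorem reApplyInnerSelf_sub_smul_le {A : E →L[ℂ] E} (hA : A.toLinearMap.IsSymmetric) {x : E}
    (hx : inner ℂ x (A x) = 0) {e : ℝ} (he : 0 ≤ e) (heA : e * ‖A‖ ≤ 1) :
    A.reApplyInnerSelf (x - (e : ℂ) • A x) ≤ -e * ‖A x‖ ^ 2 := by
  have hAA : (inner ℂ (A (A x)) (A x) : ℂ).re ≤ ‖A‖ * ‖A x‖ ^ 2 :=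
    calc (inner ℂ (A (A x)) (A x) : ℂ).re ≤ ‖A (A x)‖ * ‖A x‖ :=
          re_inner_le_norm (𝕜 := ℂ) _ _
      _ ≤ ‖A‖ * ‖A x‖ * ‖A x‖ := by gcongr; exact A.le_opNorm _
      _ = ‖A‖ * ‖A x‖ ^ 2 := by ring
  have hexpand : A.reApplyInnerSelf (x - (e : ℂ) • A x) =
      -(2 * e) * ‖A x‖ ^ 2 + e ^ 2 * (inner ℂ (A (A x)) (A x) : ℂ).re := by
    have hx' : inner ℂ (A x) x = 0 := inner_eq_zero_symm.1 hx
    have hsymm : inner ℂ (A (A x)) x = inner ℂ (A x) (A x) := hA (A x) x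
    rw [ContinuousLinearMap.reApplyInnerSelf_apply, map_sub, map_smul, inner_sub_left,
      inner_sub_right, inner_sub_right, inner_smul_left, inner_smul_right, inner_smul_right,
      inner_smul_left, hx', hsymm, inner_self_eq_norm_sq_to_K]
    simp only [Complex.coe_algebraMap, ← Complex.ofReal_pow, zero_sub, Complex.conj_ofReal,
      RCLike.re_to_complex, Complex.sub_re, Complex.neg_re, Complex.mul_re, Complex.ofReal_re,
      Complex.ofReal_im, mul_zero, sub_zero, zero_mul, Complex.mul_im, add_zero, neg_mul]
    ring
  calc A.reApplyInnerSelf (x - (e : ℂ) • A x)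
      ≤ -(2 * e) * ‖A x‖ ^ 2 + e ^ 2 * (‖A‖ * ‖A x‖ ^ 2) := by rw [hexpand]; gcongr
    _ = -(2 * e) * ‖A x‖ ^ 2 + (e * ‖A‖) * (e * ‖A x‖ ^ 2) := by ring
    _ ≤ -(2 * e) * ‖A x‖ ^ 2 + 1 * (e * ‖A x‖ ^ 2) := by gcongr
    _ = -e * ‖A x‖ ^ 2 := by ring

theorem finrank_le_operatorIndex {A : E →L[ℂ] E} (hA : A.toLinearMap.IsSymmetric)
    (M : Submodule ℂ E) [FiniteDimensional ℂ M] (hiso : ∀ x ∈ M, inner ℂ x (A x) = 0)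
    (hinj : ∀ x ∈ M, A x = 0 → x = 0) : (Module.finrank ℂ M : ℕ∞) ≤ operatorIndex A := by
  obtain ⟨K, -, hK⟩ := (A.toLinearMap.domRestrict M).exists_antilipschitzWith
    (LinearMap.ker_eq_bot'.2 fun x hx => Subtype.ext (hinj x x.2 hx))
  have hnorm (x : M) : ‖(x : E)‖ ≤ K * ‖A x‖ := by simpa using hK.le_mul_dist x 0
  set e : ℝ := (1 + ‖A‖)⁻¹ with he
  have he0 : 0 < e := by positivity
  have heA : e * ‖A‖ ≤ 1 := by
    rw [he, inv_mul_le_one₀ (by positivity)]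
    linarith
  let shift : M →ₗ[ℂ] E := M.subtype - (e : ℂ) • A.toLinearMap.domRestrict M
  have hform (x : M) : A.reApplyInnerSelf (shift x) ≤ -e * ‖A x‖ ^ 2 :=
    reApplyInnerSelf_sub_smul_le hA (hiso x x.2) he0.le heA
  have hshift : Function.Injective shift := by
    refine (injective_iff_map_eq_zero shift).2 fun x hx => Subtype.ext (hinj x x.2 ?_)
    have hx0 : 0 ≤ -e * ‖A x‖ ^ 2 := by
      simpa [hx, ContinuousLinearMap.reApplyInnerSelf_apply] using hform x
    have : ‖A x‖ ^ 2 ≤ 0 := by nlinarith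
    simpa using this
  have hle (x : M) : ‖shift x‖ ≤ (K + e) * ‖A x‖ :=
    calc ‖shift x‖ ≤ ‖(x : E)‖ + ‖(e : ℂ) • A x‖ := norm_sub_le _ _
      _ ≤ K * ‖A x‖ + e * ‖A x‖ := by
        rw [norm_smul, Complex.norm_of_nonneg he0.le]
        gcongr
        exact hnorm x
      _ = (K + e) * ‖A x‖ := by ring
  rw [← Cardinal.toENat_nat, ← LinearMap.finrank_range_of_inj hshift, Module.finrank_eq_rank]
  refine le_iSup₂_of_le (LinearMap.range shift) ⟨e / (K + e) ^ 2, by positivity, ?_⟩ le_rfl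
  rintro _ ⟨x, rfl⟩
  calc A.reApplyInnerSelf (shift x) ≤ -e * ‖A x‖ ^ 2 := hform x
    _ = -(e / (K + e) ^ 2) * ((K + e) * ‖A x‖) ^ 2 := by field_simp
    _ ≤ -(e / (K + e) ^ 2) * ‖shift x‖ ^ 2 := by
      rw [neg_mul, neg_mul, neg_le_neg_iff]
      gcongr
      exact hle x

theorem card_le_operatorIndex {ι : Type*} [Fintype ι] {A : E →L[ℂ] E}
    (hA : A.toLinearMap.IsSymmetric) (v : ι → E) (hiso : ∀ i j, inner ℂ (v i) (A (v j)) = 0)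
    (hinj : ∀ a : ι → ℂ, A (∑ i, a i • v i) = 0 → a = 0) :
    (Fintype.card ι : ℕ∞) ≤ operatorIndex A := by
  have hv : LinearIndependent ℂ v := Fintype.linearIndependent_iff.2 fun a ha =>
    congrFun (hinj a (by rw [ha, map_zero]))
  have := FiniteDimensional.span_of_finite ℂ (finite_range v)
  rw [← finrank_span_eq_card hv]
  refine finrank_le_operatorIndex hA _ (fun x hx => ?_) fun x hx hAx => ?_ <;>
    obtain ⟨a, rfl⟩ := (Submodule.mem_span_range_iff_exists_fun ℂ).1 hx
  · simp [hiso]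
  · simp [hinj a hAx]

end IndexOfInertia

section AbsolutelyContinuous

theorem absolutelyContinuousOnInterval_of_dist_le {X Y : Type*} [PseudoMetricSpace X]
    [PseudoMetricSpace Y] {f : ℝ → X} {g : ℝ → Y} {a b K : ℝ}
    (hg : AbsolutelyContinuousOnInterval g a b)
    (h : ∀ x ∈ uIcc a b, ∀ y ∈ uIcc a b, dist (f x) (f y) ≤ K * dist (g x) (g y)) :
    AbsolutelyContinuousOnInterval f a b := by
  have hK := Filter.Tendsto.const_mul K hg
  rw [mul_zero] at hK
  refine squeeze_zero' (Filter.Eventually.of_forall fun t =>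
    Finset.sum_nonneg fun _ _ => dist_nonneg) ?_ hK
  refine Filter.eventually_inf_principal.2 (Filter.Eventually.of_forall fun t ht => ?_)
  rw [Finset.mul_sum]
  exact Finset.sum_le_sum fun i hi => h _ (ht.1 i hi).1 _ (ht.1 i hi).2

variable {F G : Type*} [NormedAddCommGroup F] [NormedSpace ℝ F] [NormedAddCommGroup G]
  [NormedSpace ℝ G]

/-- `f` is absolutely continuous on `[a, b]` with almost everywhere derivative `f'`. -/
structure HasACDerivOn (f f' : ℝ → F) (a b : ℝ) : Prop where
  absolutelyContinuous : AbsolutelyContinuousOnInterval f a b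
  ae_hasDerivAt : ∀ᵐ x, x ∈ uIcc a b → HasDerivAt f (f' x) x

namespace HasACDerivOn

variable {f f' : ℝ → F} {a b : ℝ}

theorem mono (h : HasACDerivOn f f' a b) {c d : ℝ} (hcd : uIcc c d ⊆ uIcc a b) :
    HasACDerivOn f f' c d where
  absolutelyContinuous := h.absolutelyContinuous.mono hcd
  ae_hasDerivAt := h.ae_hasDerivAt.mono fun _ hx hmem => hx (hcd hmem)

theorem congr_deriv {g' : ℝ → F} (h : HasACDerivOn f f' a b)
    (hg' : ∀ᵐ x, x ∈ uIcc a b → f' x = g' x) : HasACDerivOn f g' a b where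
  absolutelyContinuous := h.absolutelyContinuous
  ae_hasDerivAt := by
    filter_upwards [h.ae_hasDerivAt, hg'] with x hx hfg hmem using hfg hmem ▸ hx hmem

theorem continuousOn_Icc (h : HasACDerivOn f f' a b) (hab : a ≤ b) : ContinuousOn f (Icc a b) :=
  uIcc_of_le hab ▸ h.absolutelyContinuous.continuousOn

theorem comp (h : HasACDerivOn f f' a b) {φ : F → G}
    (hφ : ∀ x ∈ uIcc a b, ContDiffAt ℝ 1 φ (f x)) :
    HasACDerivOn (fun x => φ (f x)) (fun x => fderiv ℝ φ (f x) (f' x)) a b where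
  absolutelyContinuous := by
    have hloc : LocallyLipschitzOn (f '' uIcc a b) φ := by
      rintro _ ⟨x, hx, rfl⟩
      obtain ⟨K, t, ht, hK⟩ := (hφ x hx).exists_lipschitzOnWith
      exact ⟨K, t, mem_nhdsWithin_of_mem_nhds ht, hK⟩
    obtain ⟨K, hK⟩ := hloc.exists_lipschitzOnWith_of_compact
      (isCompact_uIcc.image_of_continuousOn h.absolutelyContinuous.continuousOn)
    exact absolutelyContinuousOnInterval_of_dist_le h.absolutelyContinuous fun x hx y hy =>
      hK.dist_le_mul _ (mem_image_of_mem f hx) _ (mem_image_of_mem f hy)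
  ae_hasDerivAt := h.ae_hasDerivAt.mono fun x hx hmem =>
    ((hφ x hmem).differentiableAt one_ne_zero).hasFDerivAt.comp_hasDerivAt x (hx hmem)

theorem clm_comp (h : HasACDerivOn f f' a b) (L : F →L[ℝ] G) :
    HasACDerivOn (fun x => L (f x)) (fun x => L (f' x)) a b := by
  simpa only [L.fderiv] using h.comp fun x _ => L.contDiff.contDiffAt

theorem re {f f' : ℝ → ℂ} (h : HasACDerivOn f f' a b) :
    HasACDerivOn (fun x => (f x).re) (fun x => (f' x).re) a b := h.clm_comp Complex.reCLM

theorem im {f f' : ℝ → ℂ} (h : HasACDerivOn f f' a b) :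
    HasACDerivOn (fun x => (f x).im) (fun x => (f' x).im) a b := h.clm_comp Complex.imCLM

theorem star {f f' : ℝ → ℂ} (h : HasACDerivOn f f' a b) :
    HasACDerivOn (fun x => conj (f x)) (fun x => conj (f' x)) a b :=
  h.clm_comp Complex.conjCLE.toContinuousLinearMap

theorem norm_sq {F : Type*} [NormedAddCommGroup F] [InnerProductSpace ℝ F] {f f' : ℝ → F}
    (h : HasACDerivOn f f' a b) :
    HasACDerivOn (fun x => ‖f x‖ ^ 2) (fun x => 2 * inner ℝ (f x) (f' x)) a b := by
  simpa [fderiv_norm_sq_apply] using h.comp fun x _ => (contDiff_norm_sq ℝ).contDiffAt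

theorem real_comp {f f' : ℝ → ℝ} (h : HasACDerivOn f f' a b) {φ : ℝ → ℝ}
    (hφ : ∀ x ∈ uIcc a b, ContDiffAt ℝ 1 φ (f x)) :
    HasACDerivOn (fun x => φ (f x)) (fun x => deriv φ (f x) * f' x) a b := by
  simpa only [fderiv_eq_smul_deriv, smul_eq_mul, mul_comm] using h.comp hφ

theorem exp {f f' : ℝ → ℝ} (h : HasACDerivOn f f' a b) :
    HasACDerivOn (fun x => Real.exp (f x)) (fun x => Real.exp (f x) * f' x) a b := by
  simpa only [Real.deriv_exp] using h.real_comp fun x _ => Real.contDiff_exp.contDiffAt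

theorem inv {f f' : ℝ → ℝ} (h : HasACDerivOn f f' a b) (hf : ∀ x ∈ uIcc a b, f x ≠ 0) :
    HasACDerivOn (fun x => (f x)⁻¹) (fun x => -(f x ^ 2)⁻¹ * f' x) a b := by
  simpa only [deriv_inv] using h.real_comp fun x hx => contDiffAt_inv ℝ (hf x hx)

theorem ofReal {f f' : ℝ → ℝ} (h : HasACDerivOn f f' a b) :
    HasACDerivOn (fun x => (f x : ℂ)) (fun x => (f' x : ℂ)) a b := h.clm_comp Complex.ofRealCLM

theorem add {g g' : ℝ → F} (hf : HasACDerivOn f f' a b) (hg : HasACDerivOn g g' a b) :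
    HasACDerivOn (fun x => f x + g x) (fun x => f' x + g' x) a b where
  absolutelyContinuous := hf.absolutelyContinuous.fun_add hg.absolutelyContinuous
  ae_hasDerivAt := by
    filter_upwards [hf.ae_hasDerivAt, hg.ae_hasDerivAt] with x hfx hgx hx
    exact (hfx hx).add (hgx hx)

theorem neg (h : HasACDerivOn f f' a b) : HasACDerivOn (fun x => -f x) (fun x => -f' x) a b :=
  h.clm_comp (-ContinuousLinearMap.id ℝ F)

theorem mul {𝕜 : Type*} [NormedField 𝕜] [NormedAlgebra ℝ 𝕜] {f f' g g' : ℝ → 𝕜}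
    (hf : HasACDerivOn f f' a b) (hg : HasACDerivOn g g' a b) :
    HasACDerivOn (fun x => f x * g x) (fun x => f' x * g x + f x * g' x) a b where
  absolutelyContinuous := hf.absolutelyContinuous.fun_smul hg.absolutelyContinuous
  ae_hasDerivAt := by
    filter_upwards [hf.ae_hasDerivAt, hg.ae_hasDerivAt] with x hfx hgx hx
    exact (hfx hx).mul (hgx hx)

theorem monotoneOn {f f' : ℝ → ℝ} (h : HasACDerivOn f f' a b)
    (hf' : ∀ᵐ x, x ∈ uIcc a b → 0 ≤ f' x) : MonotoneOn f (uIcc a b) := by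
  intro x hx y hy hxy
  have hsub := uIcc_subset_uIcc hx hy
  rw [← sub_nonneg, ← (h.mono hsub).absolutelyContinuous.integral_deriv_eq_sub]
  refine intervalIntegral.integral_nonneg_of_ae_restrict hxy ?_
  rw [Filter.EventuallyLE, ae_restrict_iff' measurableSet_Icc]
  filter_upwards [h.ae_hasDerivAt, hf'] with t ht ht' hmem
  have hmem := hsub (Icc_subset_uIcc hmem)
  rw [(ht hmem).deriv]
  exact ht' hmem

theorem eq_zero_of_abs_deriv_le {f f' k : ℝ → ℝ} (h : HasACDerivOn f f' a b)
    {K : ℝ → ℝ} (hK : HasACDerivOn K k a b) (hf : ∀ x ∈ uIcc a b, 0 ≤ f x)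
    (hf' : ∀ᵐ x, x ∈ uIcc a b → |f' x| ≤ k x * f x) {x₀ : ℝ} (hx₀ : x₀ ∈ uIcc a b)
    (h₀ : f x₀ = 0) {x : ℝ} (hx : x ∈ uIcc a b) : f x = 0 := by
  refine le_antisymm ?_ (hf x hx)
  rcases le_total x₀ x with hle | hle
  · have hmono := (h.neg.mul hK.neg.exp).monotoneOn (by
      filter_upwards [hf'] with t ht hmem
      nlinarith [Real.exp_pos (-K t), le_abs_self (f' t), ht hmem])
    have hfx := hmono hx₀ hx hle
    simp only [h₀, neg_zero, zero_mul] at hfx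
    nlinarith [Real.exp_pos (-K x)]
  · have hmono := (h.mul hK.exp).monotoneOn (by
      filter_upwards [hf'] with t ht hmem
      nlinarith [Real.exp_pos (K t), neg_abs_le (f' t), ht hmem])
    have hfx := hmono hx hx₀ hle
    simp only [h₀, zero_mul] at hfx
    nlinarith [Real.exp_pos (K x)]

variable [CompleteSpace F]

theorem of_integral (hf' : IntervalIntegrable f' volume a b)
    (h : ∀ x ∈ uIcc a b, f x = f a + ∫ t in a..x, f' t) : HasACDerivOn f f' a b where
  absolutelyContinuous := by
    have hint {x : ℝ} (hx : x ∈ uIcc a b) : IntervalIntegrable f' volume a x :=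
      hf'.mono_set (uIcc_subset_uIcc left_mem_uIcc hx)
    have hnorm := hf'.norm.absolutelyContinuousOnInterval_intervalIntegral left_mem_uIcc
    refine absolutelyContinuousOnInterval_of_dist_le (K := 1) hnorm fun x hx y hy => ?_
    rw [one_mul, dist_eq_norm, h x hx, h y hy, add_sub_add_left_eq_sub, Real.dist_eq,
      intervalIntegral.integral_interval_sub_left (hint hx) (hint hy),
      intervalIntegral.integral_interval_sub_left (hint hx).norm (hint hy).norm]
    exact intervalIntegral.norm_integral_le_abs_integral_norm
  ae_hasDerivAt := by
    have hmax : ∀ᵐ x : ℝ, x ≠ max a b := Measure.ae_ne _ _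
    have hmin : ∀ᵐ x : ℝ, x ≠ min a b := Measure.ae_ne _ _
    filter_upwards [hf'.ae_hasDerivAt_integral, hmax, hmin] with x hx hne hne' hmem
    refine ((hx hmem a left_mem_uIcc).const_add (f a)).congr_of_eventuallyEq ?_
    filter_upwards [Icc_mem_nhds (hmem.1.lt_of_ne' hne') (hmem.2.lt_of_ne hne)] with t ht
    exact h t ht

theorem primitive (hf' : IntervalIntegrable f' volume a b) :
    HasACDerivOn (fun x => ∫ t in a..x, f' t) f' a b :=
  of_integral hf' fun x _ => by simp

theorem integral_eq_sub (h : HasACDerivOn f f' a b) (hf' : IntervalIntegrable f' volume a b) :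
    ∫ x in a..b, f' x = f b - f a := by
  have hdiff := h.add (primitive hf').neg
  obtain ⟨C, hC⟩ := hdiff.absolutelyContinuous.const_of_ae_hasDerivAt_zero
    (hdiff.ae_hasDerivAt.mono fun x hx hmem => by simpa using hx hmem)
  have hab := (hC b right_mem_uIcc).trans (hC a left_mem_uIcc).symm
  simp only [intervalIntegral.integral_same, neg_zero, add_zero, ← sub_eq_add_neg] at hab
  rw [← hab]
  abel

end HasACDerivOn

end AbsolutelyContinuous

section UnitInterval

theorem ae_unitMeasure_iff {P : ℝ → Prop} :
    (∀ᵐ x ∂unitMeasure, P x) ↔ ∀ᵐ x : ℝ, x ∈ uIcc (0 : ℝ) 1 → P x := by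
  rw [uIcc_of_le zero_le_one, ae_restrict_iff' measurableSet_Icc]

variable {F : Type*} [NormedAddCommGroup F]

theorem intervalIntegrable_of_integrable {f : ℝ → F} (hf : Integrable f unitMeasure) {x y : ℝ}
    (hx : x ∈ Icc (0 : ℝ) 1) (hy : y ∈ Icc (0 : ℝ) 1) : IntervalIntegrable f volume x y :=
  (IntegrableOn.mono_set (t := Icc (0 : ℝ) 1) hf (uIcc_subset_Icc hx hy)).intervalIntegrable

theorem integral_unitMeasure [NormedSpace ℝ F] (f : ℝ → F) :
    ∫ x, f x ∂unitMeasure = ∫ x in (0 : ℝ)..1, f x := by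
  rw [intervalIntegral.integral_of_le zero_le_one, ← integral_Icc_eq_integral_Ioc]

theorem memLp_mul_continuousOn {f u : ℝ → ℂ} (hf : MemLp f 2 unitMeasure)
    (hu : ContinuousOn u (Icc 0 1)) : MemLp (fun x => f x * u x) 2 unitMeasure := by
  obtain ⟨C, hC⟩ := isCompact_Icc.exists_bound_of_continuousOn hu
  refine hf.of_le_mul (c := C) (hf.1.mul (hu.aestronglyMeasurable measurableSet_Icc)) ?_
  filter_upwards [ae_mem] with x hx
  rw [norm_mul, mul_comm]
  exact mul_le_mul_of_nonneg_right (hC x hx) (norm_nonneg _)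

end UnitInterval

section Sobolev

theorem W.val_zero (w : W) : w.val 0 = w.initial := by simp [W.val]

theorem W.hasACDerivOn_val (w : W) : HasACDerivOn w.val w.deriv 0 1 :=
  .of_integral (intervalIntegrable_of_integrable w.deriv.integrable unitInterval.zero_mem
    unitInterval.one_mem) fun x _ => by rw [W.val_zero]; rfl

/-- Evaluation of an element of `W₂¹[0,1]` at a point of `[0,1]`. -/
def W.eval {x : ℝ} (hx : x ∈ Icc (0 : ℝ) 1) : W →ₗ[ℂ] ℂ where
  toFun w := w.val x
  map_add' w z := W.val_add w z hx
  map_smul' a w := W.val_smul a w hx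

theorem W.val_sum_smul {ι : Type*} (s : Finset ι) (a : ι → ℂ) (v : ι → W) {x : ℝ}
    (hx : x ∈ Icc (0 : ℝ) 1) : (∑ i ∈ s, a i • v i).val x = ∑ i ∈ s, a i * (v i).val x := by
  have h := map_sum (W.eval hx) (fun i => a i • v i) s
  simp only [map_smul, smul_eq_mul] at h
  exact h

theorem W.memLp_const_add_primitive (c : ℂ) (g : L2) :
    MemLp (fun x : ℝ => c + ∫ t in (0 : ℝ)..x, g t) 2 unitMeasure :=
  (memLp_const c).add g.memLp_primitive

/-- The function `c + ∫₀ˣ g` as an element of `W₂¹[0,1]`. -/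
def W.ofDeriv (c : ℂ) (g : L2) : W :=
  ⟨WithLp.toLp 2 ((W.memLp_const_add_primitive c g).toLp _, g), c,
    (W.memLp_const_add_primitive c g).coeFn_toLp⟩

theorem W.deriv_ofDeriv (c : ℂ) (g : L2) : (W.ofDeriv c g).deriv = g := rfl

theorem W.val_ofDeriv (c : ℂ) (g : L2) (x : ℝ) :
    (W.ofDeriv c g).val x = c + ∫ t in (0 : ℝ)..x, g t := by
  have h : (W.ofDeriv c g).initial = c :=
    W.initial_eq _ (W.memLp_const_add_primitive c g).coeFn_toLp
  rw [W.val, h, W.deriv_ofDeriv]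

theorem trace_surjective : Function.Surjective trace := fun c => by
  refine ⟨W.ofDeriv (c 0) (Lp.const 2 unitMeasure (c 1 - c 0)), funext fun i => ?_⟩
  change ![W.val _ 0, W.val _ 1] i = c i
  rw [W.val_ofDeriv, W.val_ofDeriv]
  have hconst : ∫ t in (0 : ℝ)..1, Lp.const 2 unitMeasure (c 1 - c 0) t = c 1 - c 0 := by
    rw [← integral_unitMeasure, integral_congr_ae (Lp.coeFn_const 2 unitMeasure (c 1 - c 0))]
    simp
  rw [hconst, intervalIntegral.integral_same]
  fin_cases i <;> simp

/-- The complex conjugate of an element of `W₂¹[0,1]`. -/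
def W.conj (w : W) : W := W.ofDeriv (starRingEnd ℂ w.initial) w.deriv.conj

theorem W.val_conj (w : W) {x : ℝ} (hx : x ∈ Icc (0 : ℝ) 1) :
    w.conj.val x = starRingEnd ℂ (w.val x) := by
  rw [W.conj, W.val_ofDeriv, L2.primitive_conj _ hx, W.val, map_add]

theorem W.deriv_conj_ae (w : W) :
    ∀ᵐ x ∂unitMeasure, w.conj.deriv x = starRingEnd ℂ (w.deriv x) := w.deriv.conj_ae

/-- The function that agrees with `y` on `[0, c]` and is constant on `[c, 1]`. -/
def W.cutoff (y : W) (c : ℝ) : W :=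
  W.ofDeriv (y.val 0) (((Lp.memLp y.deriv).indicator (measurableSet_Iic (a := c))).toLp _)

theorem W.deriv_cutoff_ae (y : W) (c : ℝ) :
    ∀ᵐ x ∂unitMeasure, (y.cutoff c).deriv x = (Iic c).indicator y.deriv x :=
  ((Lp.memLp y.deriv).indicator (measurableSet_Iic (a := c))).coeFn_toLp

theorem W.val_cutoff (y : W) {c x : ℝ} (hc : 0 ≤ c) (hx : x ∈ Icc (0 : ℝ) 1) :
    (y.cutoff c).val x = y.val (min c x) := by
  have hval : (y.cutoff c).val x = y.val 0 + ∫ t in (0 : ℝ)..x, (y.cutoff c).deriv t :=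
    W.val_ofDeriv ..
  have hint : ∫ t in (0 : ℝ)..x, (y.cutoff c).deriv t = ∫ t in Iic c ∩ Ioc 0 x, y.deriv t := by
    rw [intervalIntegral.integral_of_le hx.1, inter_comm,
      integral_congr_ae (ae_interval (y.deriv_cutoff_ae c) hx),
      setIntegral_indicator measurableSet_Iic]
  have hIoc : Iic c ∩ Ioc 0 x = Ioc 0 (min c x) := by
    ext t
    simp only [mem_inter_iff, mem_Iic, mem_Ioc, le_min_iff]
    tauto
  rw [hval, hint, hIoc, W.val_zero, W.val, intervalIntegral.integral_of_le (le_min hc hx.1)]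

end Sobolev

section Coefficients

theorem W.inner_eq (w f : W) :
    inner ℂ w f = ∫ x, (conj (w.deriv x) * f.deriv x + conj (w.val x) * f.val x) ∂unitMeasure := by
  have h : inner ℂ w f = inner ℂ w.1.fst f.1.fst + inner ℂ w.deriv f.deriv :=
    WithLp.prod_inner_apply w.1 f.1
  rw [h, L2.inner_def, L2.inner_def,
    ← integral_add (L2.integrable_inner _ _) (L2.integrable_inner _ _)]
  refine integral_congr_ae ?_
  filter_upwards [w.val_ae, f.val_ae] with x hw hf
  rw [hw, hf, RCLike.inner_apply, RCLike.inner_apply]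
  ring

theorem WNeg.IsReal.apply_conj {Q : WNeg} (hQ : Q.IsReal) (f : W) : Q f.conj = conj (Q f) := by
  have hre := hQ (f + f.conj) fun x hx => by
    rw [W.val_add _ _ hx, W.val_conj _ hx]
    simp
  have him := hQ (Complex.I • (f + (-1 : ℂ) • f.conj)) fun x hx => by
    rw [W.val_smul _ _ hx, W.val_add _ _ hx, W.val_smul _ _ hx, W.val_conj _ hx]
    simp
  simp only [map_add, map_smul, Complex.add_im, smul_eq_mul, Complex.I_mul_im, Complex.add_re,
    neg_mul, one_mul, Complex.neg_re] at hre him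
  refine Complex.ext ?_ ?_
  · rw [Complex.conj_re]
    linarith
  · rw [Complex.conj_im]
    linarith

theorem WNeg.IsReal.sub_ofReal_smul {q r : WNeg} (hq : q.IsReal) (hr : r.IsReal) (lam : ℝ) :
    WNeg.IsReal (q - (lam : ℂ) • r) := fun y hy => by
  simp [hq y hy, hr y hy]

/- Riesz' theorem represents `Q` by an element of `W₂¹[0,1]`; reality allows passing to its real
part. -/
theorem WNeg.IsReal.exists_integral {Q : WNeg} (hQ : Q.IsReal) :
    ∃ a b : ℝ → ℝ, MemLp a 2 unitMeasure ∧ MemLp b 2 unitMeasure ∧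
      ∀ f : W, Q f = ∫ x, ((a x : ℂ) * f.deriv x + (b x : ℂ) * f.val x) ∂unitMeasure := by
  obtain ⟨w, rfl⟩ := (InnerProductSpace.toDual ℂ W).surjective Q
  have hint (f : W) : Integrable (fun x => conj (w.deriv x) * f.deriv x +
      conj (w.val x) * f.val x) unitMeasure :=
    ((Lp.memLp w.deriv).star.integrable_mul (Lp.memLp f.deriv)).add
      (w.memLp_val.star.integrable_mul f.memLp_val)
  have hint_conj (f : W) : Integrable (fun x => conj (conj (w.deriv x) * f.deriv x +
      conj (w.val x) * f.val x)) unitMeasure :=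
    Complex.conjCLE.toContinuousLinearMap.integrable_comp (hint f)
  refine ⟨fun x => (w.deriv x).re, fun x => (w.val x).re, (Lp.memLp w.deriv).re, w.memLp_val.re,
    fun f => ?_⟩
  have hsymm : inner ℂ w f = (1 / 2 : ℂ) * (inner ℂ w f + conj (inner ℂ w f.conj)) := by
    have h := hQ.apply_conj f
    simp only [InnerProductSpace.toDual_apply_apply] at h
    rw [h, Complex.conj_conj]
    ring
  rw [InnerProductSpace.toDual_apply_apply, hsymm, W.inner_eq, W.inner_eq, ← integral_conj,
    ← integral_add (hint f) (hint_conj f.conj), ← integral_const_mul]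
  refine integral_congr_ae ?_
  filter_upwards [ae_mem, f.deriv_conj_ae] with x hx hderiv
  rw [hderiv, f.val_conj hx, Complex.re_eq_add_conj, Complex.re_eq_add_conj]
  simp only [map_add, map_mul, Complex.conj_conj]
  ring

/-- Real coefficients of the form
`∫ (p y' z̄' + a (y z̄)' + b y z̄) dx + v₀ y(0) z̄(0) + v₁ y(1) z̄(1)`: the distribution `q - λ r`
is encoded as `b - a'` with `a, b ∈ L₂[0,1]`. -/
structure SturmData where
  p : ℝ → ℝ
  a : ℝ → ℝ
  b : ℝ → ℝ
  v : Fin 2 → ℝ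
  lower : ℝ
  upper : ℝ
  lower_pos : 0 < lower
  aestronglyMeasurable_p : AEStronglyMeasurable p unitMeasure
  lower_le : ∀ᵐ x ∂unitMeasure, lower ≤ p x
  le_upper : ∀ᵐ x ∂unitMeasure, p x ≤ upper
  memLp_a : MemLp a 2 unitMeasure
  memLp_b : MemLp b 2 unitMeasure

namespace SturmData

variable (d : SturmData)

/-- The integrand of the form with coefficients `d`. -/
def density (y z : W) (x : ℝ) : ℂ :=
  (d.p x : ℂ) * y.deriv x * conj (z.deriv x) +
    ((d.a x : ℂ) * (y.deriv x * conj (z.val x) + y.val x * conj (z.deriv x)) +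
    (d.b x : ℂ) * (y.val x * conj (z.val x)))

/-- The sesquilinear form with coefficients `d`, linear in `y` and antilinear in `z`. -/
def form (y z : W) : ℂ :=
  (∫ x, d.density y z x ∂unitMeasure) + ∑ i, (d.v i : ℂ) * (trace y i * conj (trace z i))

theorem memLp_p_mul {f : ℝ → ℂ} (hf : MemLp f 2 unitMeasure) :
    MemLp (fun x => (d.p x : ℂ) * f x) 2 unitMeasure := by
  refine hf.of_le_mul (c := d.upper)
    ((Complex.continuous_ofReal.comp_aestronglyMeasurable d.aestronglyMeasurable_p).mul hf.1) ?_
  filter_upwards [d.lower_le, d.le_upper] with x hlower hupper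
  rw [norm_mul, Complex.norm_real, Real.norm_of_nonneg (d.lower_pos.le.trans hlower)]
  exact mul_le_mul_of_nonneg_right hupper (norm_nonneg _)

theorem integrable_p_mul_deriv_mul (y z : W) :
    Integrable (fun x => (d.p x : ℂ) * y.deriv x * conj (z.deriv x)) unitMeasure :=
  (d.memLp_p_mul (Lp.memLp y.deriv)).integrable_mul (Lp.memLp z.deriv).star

theorem integrable_lowerOrder (y z : W) :
    Integrable (fun x => (d.a x : ℂ) * (y.deriv x * conj (z.val x) + y.val x * conj (z.deriv x)) +
      (d.b x : ℂ) * (y.val x * conj (z.val x))) unitMeasure := by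
  have hderiv := (memLp_mul_continuousOn (Lp.memLp y.deriv) z.continuousOn_conj_val).add
    ((memLp_mul_continuousOn z.deriv.memLp_conj y.continuousOn_val).ae_eq
      (Filter.Eventually.of_forall fun x => mul_comm _ _))
  exact (d.memLp_a.ofReal.integrable_mul hderiv).add (d.memLp_b.ofReal.integrable_mul
    (memLp_mul_continuousOn y.memLp_val z.continuousOn_conj_val))

theorem integrable_density (y z : W) : Integrable (d.density y z) unitMeasure :=
  (d.integrable_p_mul_deriv_mul y z).add (d.integrable_lowerOrder y z)

theorem form_conj (y z : W) : d.form z y = conj (d.form y z) := by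
  have h (x : ℝ) : d.density z y x = conj (d.density y z x) := by
    simp only [density, map_add, map_mul, Complex.conj_ofReal, Complex.conj_conj]
    ring
  simp only [form, h, integral_conj, map_add, map_sum, map_mul, Complex.conj_ofReal,
    Complex.conj_conj, mul_comm (trace z _)]

end SturmData

theorem W.deriv_mulConj_ae (y z : W) : ∀ᵐ x ∂unitMeasure,
    (y.mulConj z).deriv x = y.deriv x * conj (z.val x) + y.val x * conj (z.deriv x) := by
  filter_upwards [Lp.coeFn_add (L2.cmul _ z.continuousOn_conj_val y.deriv)
    (L2.cmul _ y.continuousOn_val z.deriv.conj), L2.cmul_ae _ z.continuousOn_conj_val y.deriv,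
    L2.cmul_ae _ y.continuousOn_val z.deriv.conj, z.deriv.conj_ae] with x hadd hy hz hconj
  change y.derivMulConj z x = _
  rw [W.derivMulConj, hadd, Pi.add_apply, hy, hz, hconj]
  ring

theorem exists_boundaryMatrix_eq_diagonal (U : Matrix (Fin 2) (Fin 2) ℂ) :
    ∃ v : Fin 2 → ℝ, boundaryMatrix U = Matrix.diagonal fun i => (v i : ℂ) := by
  classical
  refine ⟨fun i => if U i i = 1 then 0 else -Real.cot (Complex.arg (U i i) / 2), ?_⟩
  rw [boundaryMatrix]
  congr 1
  funext i
  by_cases hi : U i i = 1 <;> simp [hi]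

theorem ae_norm_le_norm {α F : Type*} [MeasurableSpace α] {μ : Measure α}
    [NormedAddCommGroup F] (f : Lp F ∞ μ) :
    ∀ᵐ x ∂μ, ‖f x‖ ≤ ‖f‖ := by
  filter_upwards [ae_le_eLpNormEssSup (f := f) (μ := μ)] with x hx
  rw [Lp.norm_def, eLpNorm_exponent_top, ← toReal_enorm]
  exact ENNReal.toReal_mono (eLpNorm_exponent_top (f := f) ▸ Lp.eLpNorm_ne_top f) hx

theorem exists_sturmData (p : Lp ℝ ∞ unitMeasure)
    (hp : ∃ c : ℝ, 0 < c ∧ ∀ᵐ x ∂unitMeasure, c ≤ p x) (q r : WNeg) (hq : q.IsReal)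
    (hr : r.IsReal) (U : Matrix (Fin 2) (Fin 2) ℂ) (lam : ℝ) :
    ∃ d : SturmData, ∀ y z : W, form p q r U (lam : ℂ) y z = d.form y z := by
  obtain ⟨c, hc, hpc⟩ := hp
  obtain ⟨a, b, ha, hb, hQ⟩ := (hq.sub_ofReal_smul hr lam).exists_integral
  obtain ⟨v, hv⟩ := exists_boundaryMatrix_eq_diagonal U
  have hupper : ∀ᵐ x ∂unitMeasure, p x ≤ ‖p‖ :=
    (ae_norm_le_norm p).mono fun x hx => (le_abs_self _).trans hx
  let d : SturmData := ⟨p, a, b, v, c, ‖p‖, hc, Lp.aestronglyMeasurable p, hpc, hupper, ha, hb⟩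
  refine ⟨d, fun y z => ?_⟩
  have hlower : (q - (lam : ℂ) • r) (y.mulConj z) = ∫ x, ((a x : ℂ) *
      (y.deriv x * conj (z.val x) + y.val x * conj (z.deriv x)) +
      (b x : ℂ) * (y.val x * conj (z.val x))) ∂unitMeasure := by
    rw [hQ]
    refine integral_congr_ae ?_
    filter_upwards [ae_mem, y.deriv_mulConj_ae z] with x hx hderiv
    rw [W.val_mulConj _ _ hx, hderiv]
  have hboundary : (boundaryMatrix U).mulVec (trace y) ⬝ᵥ star (trace z) =
      ∑ i, (v i : ℂ) * (trace y i * conj (trace z i)) := by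
    simp [hv, Matrix.mulVec_diagonal, dotProduct, mul_assoc]
  rw [SturmLiouville.form, hlower, hboundary,
    ← integral_add (d.integrable_p_mul_deriv_mul y z) (d.integrable_lowerOrder y z)]
  rfl

theorem mem_HU_iff {U : Matrix (Fin 2) (Fin 2) ℂ} (hU : U.IsDiag) {y : W} :
    y ∈ HU U ↔ ∀ i, U i i = 1 → trace y i = 0 := by
  have hsub : U - 1 = Matrix.diagonal fun i => U i i - 1 := by
    conv_lhs => rw [← hU.diagonal_diag, ← Matrix.diagonal_one, Matrix.diagonal_sub]
    rfl
  have hmem : y ∈ HU U ↔ ∃ c : Fin 2 → ℂ, (U - 1).mulVec c = trace y := Iff.rfl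
  simp only [hmem, hsub, funext_iff, Matrix.mulVec_diagonal]
  refine ⟨fun ⟨c, hc⟩ i hi => by simp [← hc, hi], fun h =>
    ⟨fun i => trace y i / (U i i - 1), fun i => mul_div_cancel_of_imp' fun hi => ?_⟩⟩
  exact h i (sub_eq_zero.1 hi)

end Coefficients

section Solutions

theorem trace_zero (y : W) : trace y 0 = y.val 0 := rfl

theorem trace_one (y : W) : trace y 1 = y.val 1 := rfl

theorem exists_ae_eq_const_of_integral_mul_conj_deriv_eq_zero {f : ℝ → ℂ}
    (hf : MemLp f 2 unitMeasure)
    (h : ∀ z : W, trace z = 0 → ∫ x, f x * conj (z.deriv x) ∂unitMeasure = 0) :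
    ∃ c, ∀ᵐ x ∂unitMeasure, f x = c := by
  refine ⟨∫ x, f x ∂unitMeasure, ?_⟩
  set c := ∫ x, f x ∂unitMeasure
  have hgm : MemLp (fun x => f x - c) 2 unitMeasure := hf.sub (memLp_const c)
  set g : L2 := hgm.toLp _
  have hg : ∀ᵐ x ∂unitMeasure, g x = f x - c := hgm.coeFn_toLp
  have hmean : ∫ x, g x ∂unitMeasure = 0 := by
    rw [integral_congr_ae hg, integral_sub (hf.integrable one_le_two) (integrable_const c)]
    simp [c]
  have htrace : trace (W.ofDeriv 0 g) = 0 := by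
    funext i
    fin_cases i
    · simp [trace_zero, W.val_ofDeriv]
    · simp [trace_one, W.val_ofDeriv, ← integral_unitMeasure, hmean]
  have hinner : inner ℂ g g = 0 := by
    have hconst : ∫ x, c * conj (g x) ∂unitMeasure = 0 := by
      rw [integral_const_mul, integral_conj, hmean, map_zero, mul_zero]
    have hdiff : inner ℂ g g = ∫ x, (f x * conj (g x) - c * conj (g x)) ∂unitMeasure := by
      rw [L2.inner_def]
      refine integral_congr_ae ?_
      filter_upwards [hg] with x hx
      rw [RCLike.inner_apply, ← sub_mul, ← hx]
    have hint : Integrable (fun x => f x * conj (g x)) unitMeasure :=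
      hf.integrable_mul g.memLp_conj
    rw [hdiff, integral_sub hint ((g.memLp_conj.integrable one_le_two).const_mul c), hconst,
      sub_zero]
    exact h _ htrace
  filter_upwards [hg, Lp.coeFn_zero ℂ 2 unitMeasure] with x hx hzero
  rw [inner_self_eq_zero.1 hinner, hzero] at hx
  exact sub_eq_zero.1 hx.symm

theorem W.integrable_mul_conj_deriv_add (z : W) {f f' : ℝ → ℂ} (hf : ContinuousOn f (Icc 0 1))
    (hf' : Integrable f' unitMeasure) :
    Integrable (fun x => f x * conj (z.deriv x) + f' x * conj (z.val x)) unitMeasure := by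
  have hderiv := (memLp_mul_continuousOn z.deriv.memLp_conj hf).integrable one_le_two
  simp only [mul_comm _ (f _)] at hderiv
  exact hderiv.add (IntegrableOn.mul_continuousOn hf' z.continuousOn_conj_val isCompact_Icc)

theorem W.integral_mul_conj_deriv_add (z : W) {f f' : ℝ → ℂ} (hf : HasACDerivOn f f' 0 1)
    (hf' : Integrable f' unitMeasure) :
    ∫ x, (f x * conj (z.deriv x) + f' x * conj (z.val x)) ∂unitMeasure =
      f 1 * conj (z.val 1) - f 0 * conj (z.val 0) := by
  have hint := z.integrable_mul_conj_deriv_add (hf.continuousOn_Icc zero_le_one) hf'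
  rw [integral_unitMeasure, ← (hf.mul z.hasACDerivOn_val.star).integral_eq_sub]
  · simp only [add_comm]
  · simpa only [add_comm] using intervalIntegrable_of_integrable hint unitInterval.zero_mem
      unitInterval.one_mem

namespace SturmData

variable (d : SturmData)

/-- The quasi-derivative `p y' + a y`, defined almost everywhere. -/
def quasiDeriv (y : W) (x : ℝ) : ℂ := (d.p x : ℂ) * y.deriv x + (d.a x : ℂ) * y.val x

/-- The derivative `a y' + b y` of the quasi-derivative of a solution. -/
def rate (y : W) (x : ℝ) : ℂ := (d.a x : ℂ) * y.deriv x + (d.b x : ℂ) * y.val x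

/-- `u` is the absolutely continuous quasi-derivative of a solution `y` of
`-(p y' + a y)' + a y' + b y = 0` on `[0,1]`. -/
structure IsSolution (y : W) (u : ℝ → ℂ) : Prop where
  ae_eq : ∀ᵐ x ∂unitMeasure, u x = d.quasiDeriv y x
  hasACDerivOn : HasACDerivOn u (d.rate y) 0 1

theorem memLp_quasiDeriv (y : W) : MemLp (d.quasiDeriv y) 2 unitMeasure :=
  (d.memLp_p_mul (Lp.memLp y.deriv)).add
    (memLp_mul_continuousOn d.memLp_a.ofReal y.continuousOn_val)

theorem integrable_rate (y : W) : Integrable (d.rate y) unitMeasure :=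
  (d.memLp_a.ofReal.integrable_mul (Lp.memLp y.deriv)).add
    (d.memLp_b.ofReal.integrable_mul y.memLp_val)

theorem density_eq (y z : W) (x : ℝ) : d.density y z x =
    d.quasiDeriv y x * conj (z.deriv x) + d.rate y x * conj (z.val x) := by
  simp only [density, quasiDeriv, rate]
  ring

theorem exists_isSolution {y : W} (hy : ∀ z, trace z = 0 → d.form y z = 0) :
    ∃ u, d.IsSolution y u := by
  have hrate := d.integrable_rate y
  have hB := HasACDerivOn.primitive
    (intervalIntegrable_of_integrable hrate unitInterval.zero_mem unitInterval.one_mem)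
  set B : ℝ → ℂ := fun x => ∫ t in (0 : ℝ)..x, d.rate y t
  have hBm : MemLp B 2 unitMeasure := by
    simpa using memLp_mul_continuousOn (memLp_const (1 : ℂ)) (hB.continuousOn_Icc zero_le_one)
  have hm : MemLp (fun x => d.quasiDeriv y x - B x) 2 unitMeasure := (d.memLp_quasiDeriv y).sub hBm
  obtain ⟨c, hc⟩ := exists_ae_eq_const_of_integral_mul_conj_deriv_eq_zero hm fun z hz => by
    have hz₀ : z.val 0 = 0 := congrFun hz 0
    have hz₁ : z.val 1 = 0 := congrFun hz 1
    have hparts := z.integral_mul_conj_deriv_add hB hrate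
    have hform := hy z hz
    simp only [hz₀, hz₁, map_zero, mul_zero, sub_zero] at hparts
    simp only [form, hz, Pi.zero_apply, map_zero, mul_zero, Finset.sum_const_zero, add_zero,
      density_eq] at hform
    rw [← sub_eq_zero.2 (hform.trans hparts.symm), ← integral_sub]
    · congr 1
      funext x
      ring
    · exact (d.integrable_density y z).congr (.of_forall fun x => d.density_eq y z x)
    · exact z.integrable_mul_conj_deriv_add (hB.continuousOn_Icc zero_le_one) hrate
  refine ⟨fun x => c + B x, ?_, ?_⟩
  · filter_upwards [hc] with x hx
    rw [← hx, sub_add_cancel]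
  · refine .of_integral (intervalIntegrable_of_integrable hrate unitInterval.zero_mem
      unitInterval.one_mem) fun x _ => ?_
    simp [B]

variable {d} {y : W} {u : ℝ → ℂ}

/-- The outward conormal derivatives of a solution with quasi-derivative `u`. -/
def conormal (u : ℝ → ℂ) : Fin 2 → ℂ := ![-u 0, u 1]

theorem IsSolution.form_eq (h : d.IsSolution y u) (z : W) :
    d.form y z = ∑ i, (conormal u i + d.v i * trace y i) * conj (trace z i) := by
  have hdensity : ∫ x, d.density y z x ∂unitMeasure =
      ∫ x, (u x * conj (z.deriv x) + d.rate y x * conj (z.val x)) ∂unitMeasure := by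
    refine integral_congr_ae ?_
    filter_upwards [h.ae_eq] with x hx
    rw [density_eq, hx]
  rw [form, hdensity, z.integral_mul_conj_deriv_add h.hasACDerivOn (d.integrable_rate y)]
  simp only [Fin.sum_univ_two, conormal, trace_zero, trace_one, Matrix.cons_val_zero,
    Matrix.cons_val_one]
  ring

theorem IsSolution.conormal_add_eq_zero (h : d.IsSolution y u) {E : Set (Fin 2)}
    (hy : ∀ z, (∀ i ∈ E, trace z i = 0) → d.form y z = 0) {i : Fin 2} (hi : i ∉ E) :
    conormal u i + d.v i * trace y i = 0 := by
  obtain ⟨z, hz⟩ := trace_surjective (Pi.single i 1)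
  have hform := hy z fun j hj => by
    rw [hz, Pi.single_eq_of_ne (ne_of_mem_of_not_mem hj hi)]
  simpa [h.form_eq, hz, Pi.single_apply] using hform

end SturmData

end Solutions

section UniqueContinuation

theorem two_mul_add_two_mul_le {l A B Y Y' V V' : ℝ} (hl : 0 < l) (hA : 0 ≤ A) (hB : 0 ≤ B)
    (hY : 0 ≤ Y) (hV : 0 ≤ V) (hY' : l * Y' ≤ V + A * Y) (hV' : V' ≤ A * Y' + B * Y) :
    2 * (Y * Y') + 2 * (V * V') ≤ ((1 + A) ^ 2 / l + B) * (Y ^ 2 + V ^ 2) := by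
  have hVV' := mul_le_mul_of_nonneg_left hV' hV
  have hYAV := mul_le_mul_of_nonneg_left hY' (add_nonneg hY (mul_nonneg hA hV))
  have hBYV := mul_nonneg hB (sq_nonneg (Y - V))
  have hAYV := mul_nonneg (add_nonneg zero_le_one (sq_nonneg A)) (sq_nonneg (Y - V))
  have hl' : 2 * ((Y + A * V) * Y') ≤ (1 + A) ^ 2 / l * (Y ^ 2 + V ^ 2) := by
    rw [div_mul_eq_mul_div, le_div_iff₀ hl]
    linarith
  linarith

namespace SturmData

variable {d : SturmData} {y : W} {u : ℝ → ℂ}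

theorem IsSolution.lower_mul_norm_deriv_le (h : d.IsSolution y u) :
    ∀ᵐ x ∂unitMeasure, d.lower * ‖y.deriv x‖ ≤ ‖u x‖ + |d.a x| * ‖y.val x‖ := by
  filter_upwards [h.ae_eq, d.lower_le] with x hu hp
  calc d.lower * ‖y.deriv x‖ ≤ |d.p x| * ‖y.deriv x‖ := by
        gcongr
        exact hp.trans (le_abs_self _)
    _ = ‖u x - d.a x * y.val x‖ := by
      rw [hu, quasiDeriv, add_sub_cancel_right, norm_mul, Complex.norm_real, Real.norm_eq_abs]
    _ ≤ ‖u x‖ + |d.a x| * ‖y.val x‖ := by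
      simpa only [norm_mul, Complex.norm_real, Real.norm_eq_abs] using
        norm_sub_le (u x) (d.a x * y.val x)

theorem norm_rate_le (d : SturmData) (y : W) (x : ℝ) :
    ‖d.rate y x‖ ≤ |d.a x| * ‖y.deriv x‖ + |d.b x| * ‖y.val x‖ := by
  simpa only [rate, norm_mul, Complex.norm_real, Real.norm_eq_abs] using
    norm_add_le (d.a x * y.deriv x : ℂ) (d.b x * y.val x)

/-- The growth rate of the energy `‖y‖² + ‖u‖²` in Gronwall's estimate. -/
def energyRate (d : SturmData) (x : ℝ) : ℝ := (1 + |d.a x|) ^ 2 / d.lower + |d.b x|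

theorem integrable_energyRate (d : SturmData) : Integrable d.energyRate unitMeasure := by
  have h_one : MemLp (fun _ : ℝ => (1 : ℝ)) 2 unitMeasure := memLp_const 1
  have ha : MemLp (fun x => |d.a x|) 2 unitMeasure := d.memLp_a.abs
  have hsq := (h_one.add ha).integrable_sq
  exact (hsq.div_const d.lower).add (d.memLp_b.integrable one_le_two).abs

theorem IsSolution.val_eq_zero (h : d.IsSolution y u) {x₀ : ℝ} (hx₀ : x₀ ∈ Icc (0 : ℝ) 1)
    (hy : y.val x₀ = 0) (hu : u x₀ = 0) {x : ℝ} (hx : x ∈ Icc (0 : ℝ) 1) : y.val x = 0 := by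
  have henergy := y.hasACDerivOn_val.norm_sq.add h.hasACDerivOn.norm_sq
  have hbound : ∀ᵐ t : ℝ, t ∈ uIcc (0 : ℝ) 1 →
      |2 * inner ℝ (y.val t) (y.deriv t) + 2 * inner ℝ (u t) (d.rate y t)| ≤
        d.energyRate t * (‖y.val t‖ ^ 2 + ‖u t‖ ^ 2) := by
    refine ae_unitMeasure_iff.1 ?_
    filter_upwards [h.lower_mul_norm_deriv_le] with t hderiv
    calc _ ≤ 2 * |inner ℝ (y.val t) (y.deriv t)| + 2 * |inner ℝ (u t) (d.rate y t)| := by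
          simpa only [abs_mul, abs_two] using abs_add_le (2 * inner ℝ (y.val t) (y.deriv t))
            (2 * inner ℝ (u t) (d.rate y t))
      _ ≤ 2 * (‖y.val t‖ * ‖y.deriv t‖) + 2 * (‖u t‖ * ‖d.rate y t‖) := by
          gcongr <;> exact abs_real_inner_le_norm _ _
      _ ≤ d.energyRate t * (‖y.val t‖ ^ 2 + ‖u t‖ ^ 2) :=
          two_mul_add_two_mul_le d.lower_pos (abs_nonneg _) (abs_nonneg _) (norm_nonneg _)
            (norm_nonneg _) hderiv (d.norm_rate_le y t)
  have hzero := henergy.eq_zero_of_abs_deriv_le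
    (.primitive (intervalIntegrable_of_integrable d.integrable_energyRate
      unitInterval.zero_mem unitInterval.one_mem))
    (fun t _ => by positivity) hbound (uIcc_of_le (zero_le_one (α := ℝ)) ▸ hx₀)
    (by simp [hy, hu]) (uIcc_of_le (zero_le_one (α := ℝ)) ▸ hx)
  rw [← norm_eq_zero, ← sq_eq_zero_iff]
  nlinarith [sq_nonneg ‖y.val x‖, sq_nonneg ‖u x‖]

theorem IsSolution.ne_zero_of_val_eq_zero (h : d.IsSolution y u) (hy : y ≠ 0) {x₀ : ℝ}
    (hx₀ : x₀ ∈ Icc (0 : ℝ) 1) (hyx₀ : y.val x₀ = 0) : u x₀ ≠ 0 := fun hu =>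
  hy (W.ext_val fun _ hx =>
    (h.val_eq_zero hx₀ hyx₀ hu hx).trans (map_zero (W.eval hx)).symm)

theorem IsSolution.frequently_val_ne_zero (h : d.IsSolution y u) (hy : y ≠ 0) {c : ℝ}
    (hc : c ∈ Ioc (0 : ℝ) 1) : ∃ᶠ x in nhdsWithin c (Iio c), y.val x ≠ 0 := by
  intro hzero
  simp only [not_not] at hzero
  obtain ⟨s, hsc, hs⟩ := mem_nhdsLT_iff_exists_Ioo_subset.1
    (Filter.inter_mem hzero (Ioo_mem_nhdsLT hc.1))
  have hae : ∀ᵐ t : ℝ, t ∈ uIcc (0 : ℝ) 1 →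
      HasDerivAt y.val (y.deriv t) t ∧ u t = d.quasiDeriv y t := by
    filter_upwards [y.hasACDerivOn_val.ae_hasDerivAt, ae_unitMeasure_iff.1 h.ae_eq]
      with t hderiv hu ht using ⟨hderiv ht, hu ht⟩
  obtain ⟨t, hts, ht⟩ : ∃ t ∈ Ioo s c, t ∈ uIcc (0 : ℝ) 1 →
      HasDerivAt y.val (y.deriv t) t ∧ u t = d.quasiDeriv y t :=
    Measure.exists_mem_of_measure_ne_zero_of_ae
      (isOpen_Ioo.measure_pos volume (nonempty_Ioo.2 hsc)).ne' (ae_restrict_of_ae hae)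
  have hmem : t ∈ Icc (0 : ℝ) 1 := ⟨(hs hts).2.1.le, (hs hts).2.2.le.trans hc.2⟩
  obtain ⟨hderiv, hu⟩ := ht (Icc_subset_uIcc hmem)
  have hval : y.val =ᶠ[nhds t] fun _ => 0 :=
    Filter.mem_of_superset (Ioo_mem_nhds hts.1 hts.2) fun z hz => (hs hz).1
  have hderiv_zero := hderiv.unique ((hasDerivAt_const t (0 : ℂ)).congr_of_eventuallyEq hval)
  have hyt : y.val t = 0 := hval.eq_of_nhds
  have hut : u t = 0 := by simp [hu, quasiDeriv, hderiv_zero, hyt]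
  exact h.ne_zero_of_val_eq_zero hy hmem hyt hut

end SturmData

end UniqueContinuation

section LowerBound

theorem eq_zero_of_sum_tail_eq_zero {ι M : Type*} [Fintype ι] [LinearOrder ι] [AddCommMonoid M]
    {a : ι → M} (h : ∀ i, ∑ j with i ≤ j, a j = 0) : a = 0 := by
  funext i
  induction i using WellFoundedGT.induction with
  | ind i ih =>
    rw [Pi.zero_apply, ← h i, Finset.sum_eq_single i]
    · exact fun j hj hji => ih j (lt_of_le_of_ne (Finset.mem_filter.1 hj).2 hji.symm)
    · simp

theorem W.val_sum_cutoff {ι : Type*} [Fintype ι] (y : W) {c : ι → ℝ} (hc : ∀ i, 0 ≤ c i)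
    (hy : ∀ i, y.val (c i) = 0) (a : ι → ℂ) {x : ℝ} (hx : x ∈ Icc (0 : ℝ) 1) :
    (∑ i, a i • y.cutoff (c i)).val x = (∑ i with x ≤ c i, a i) * y.val x := by
  rw [W.val_sum_smul _ _ _ hx, Finset.sum_filter, Finset.sum_mul]
  refine Finset.sum_congr rfl fun i _ => ?_
  rw [y.val_cutoff (hc i) hx]
  split_ifs with h
  · rw [min_eq_right h]
  · rw [min_eq_left (not_le.1 h).le, hy, mul_zero, zero_mul]

theorem trace_cutoff_eq_zero {y : W} {c : ℝ} (hc : c ∈ Icc (0 : ℝ) 1) (hyc : y.val c = 0)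
    {i : Fin 2} (hi : trace y i = 0) : trace (y.cutoff c) i = 0 := by
  fin_cases i
  · exact (y.val_cutoff hc.1 unitInterval.zero_mem).trans
      ((congrArg y.val (min_eq_right hc.1)).trans hi)
  · exact (y.val_cutoff hc.1 unitInterval.one_mem).trans
      ((congrArg y.val (min_eq_left hc.2)).trans hyc)

namespace SturmData

variable {d : SturmData} {y : W} {u : ℝ → ℂ}

theorem form_cutoff_cutoff {c e : ℝ} (hc : c ∈ Icc (0 : ℝ) 1) (hyc : y.val c = 0) (hce : c ≤ e) :
    d.form (y.cutoff e) (y.cutoff c) = d.form y (y.cutoff c) := by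
  have hdensity : ∫ x, d.density (y.cutoff e) (y.cutoff c) x ∂unitMeasure =
      ∫ x, d.density y (y.cutoff c) x ∂unitMeasure := by
    refine integral_congr_ae ?_
    filter_upwards [ae_mem, y.deriv_cutoff_ae c, y.deriv_cutoff_ae e] with x hx hderiv_c hderiv_e
    rcases le_or_gt x c with hxc | hxc
    · have hxe := hxc.trans hce
      simp only [density, hderiv_e, y.val_cutoff (hc.1.trans hce) hx, min_eq_right hxe,
        indicator_of_mem (mem_Iic.2 hxe)]
    · simp only [density, hderiv_c, y.val_cutoff hc.1 hx, min_eq_left hxc.le, hyc,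
        indicator_of_notMem (notMem_Iic.2 hxc), map_zero, mul_zero, add_zero]
  have hzero : trace (y.cutoff e) 0 = trace y 0 :=
    (y.val_cutoff (hc.1.trans hce) unitInterval.zero_mem).trans
      (congrArg y.val (min_eq_right (hc.1.trans hce)))
  have hone : trace (y.cutoff c) 1 = 0 :=
    (y.val_cutoff hc.1 unitInterval.one_mem).trans
      ((congrArg y.val (min_eq_left hc.2)).trans hyc)
  simp only [form, hdensity, Fin.sum_univ_two, hzero, hone, map_zero, mul_zero, add_zero]

theorem form_cutoff_cutoff_eq_zero {E : Set (Fin 2)} (hyE : ∀ i ∈ E, trace y i = 0)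
    (hy : ∀ z, (∀ i ∈ E, trace z i = 0) → d.form y z = 0) {c e : ℝ} (hc : c ∈ Icc (0 : ℝ) 1)
    (he : e ∈ Icc (0 : ℝ) 1) (hyc : y.val c = 0) (hye : y.val e = 0) :
    d.form (y.cutoff e) (y.cutoff c) = 0 := by
  wlog hce : c ≤ e generalizing c e
  · rw [d.form_conj, this he hc hye hyc (le_of_not_ge hce), map_zero]
  rw [form_cutoff_cutoff hc hyc hce]
  exact hy _ fun i hi => trace_cutoff_eq_zero hc hyc (hyE i hi)

theorem IsSolution.eq_zero_of_sum_cutoff_eq_zero (h : d.IsSolution y u) (hy : y ≠ 0) {S : Finset ℝ}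
    (hS : ∀ c ∈ S, c ∈ Ioo (0 : ℝ) 1 ∧ y.val c = 0) {a : S → ℂ}
    (ha : ∑ c, a c • y.cutoff c = 0) : a = 0 := by
  refine eq_zero_of_sum_tail_eq_zero fun c => ?_
  have hc := (hS c c.2).1
  have htail : ∀ᶠ x : ℝ in nhdsWithin (c : ℝ) (Iio c), ∀ e : S, x ≤ e ↔ c ≤ e := by
    refine Filter.eventually_all.2 fun e => ?_
    rcases le_or_gt c e with hce | hec
    · filter_upwards [self_mem_nhdsWithin] with x hx
      exact iff_of_true ((mem_Iio.1 hx).le.trans hce) hce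
    · filter_upwards [Ioo_mem_nhdsLT (Subtype.coe_lt_coe.2 hec)] with x hx
      exact iff_of_false hx.1.not_ge hec.not_ge
  obtain ⟨x, hyx, hxe, hx⟩ := ((h.frequently_val_ne_zero hy ⟨hc.1, hc.2.le⟩).and_eventually
    (htail.and (Ioo_mem_nhdsLT hc.1))).exists
  have hmem : x ∈ Icc (0 : ℝ) 1 := ⟨hx.1.le, hx.2.le.trans hc.2.le⟩
  have hval := y.val_sum_cutoff (fun c : S => (hS c c.2).1.1.le) (fun c => (hS c c.2).2) a hmem
  rw [ha, show W.val 0 x = 0 from map_zero (W.eval hmem)] at hval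
  simpa only [hxe] using (mul_eq_zero.1 hval.symm).resolve_right hyx

theorem IsSolution.sum_cutoff_eq_zero {S : Finset ℝ}
    (hS : ∀ c ∈ S, c ∈ Ioo (0 : ℝ) 1 ∧ y.val c = 0) {a : S → ℂ} {w : ℝ → ℂ}
    (hw : d.IsSolution (∑ c, a c • y.cutoff c) w) : ∑ c, a c • y.cutoff c = 0 := by
  by_contra hne
  have hright : ∀ᶠ x in nhdsWithin (1 : ℝ) (Iio 1), ∀ c : S, (c : ℝ) < x :=
    Filter.eventually_all.2 fun c => Filter.mem_of_superset (Ioo_mem_nhdsLT (hS c c.2).1.2)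
      fun x hx => hx.1
  obtain ⟨x, hwx, hcx, hx⟩ := ((hw.frequently_val_ne_zero hne ⟨one_pos, le_rfl⟩).and_eventually
    (hright.and (Ioo_mem_nhdsLT zero_lt_one))).exists
  refine hwx ?_
  rw [y.val_sum_cutoff (fun c : S => (hS c c.2).1.1.le) (fun c => (hS c c.2).2) a
    ⟨hx.1.le, hx.2.le⟩, Finset.sum_eq_zero, zero_mul]
  exact fun c hc => absurd (hcx c) (Finset.mem_filter.1 hc).2.not_gt

end SturmData

section Index

open SturmData

variable {d : SturmData} {E : Set (Fin 2)} {H : Submodule ℂ W}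
  (hH : ∀ z, z ∈ H ↔ ∀ i ∈ E, trace z i = 0) {A : H →L[ℂ] H}
  (hA : ∀ w z : H, inner ℂ z (A w) = d.form w z)

include hA

theorem isSymmetric_of_inner_eq_form : A.toLinearMap.IsSymmetric := fun w z => by
  rw [ContinuousLinearMap.coe_coe, ← inner_conj_symm, hA, hA, ← d.form_conj]

include hH

theorem form_eq_zero_of_apply_eq_zero {w : H} (hw : A w = 0) :
    ∀ z, (∀ i ∈ E, trace z i = 0) → d.form w z = 0 := fun z hz => by
  rw [← hA w ⟨z, (hH z).2 hz⟩, hw, inner_zero_right]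

theorem exists_isSolution_of_apply_eq_zero {w : H} (hw : A w = 0) : ∃ u, d.IsSolution w u :=
  d.exists_isSolution fun z hz =>
    form_eq_zero_of_apply_eq_zero hH hA hw z fun i _ => congrFun hz i

theorem card_zeros_le_operatorIndex {y : H} (hy : y ≠ 0) (hAy : A y = 0) {S : Finset ℝ}
    (hS : ∀ c ∈ S, c ∈ Ioo (0 : ℝ) 1 ∧ (y : W).val c = 0) :
    (S.card : ℕ∞) ≤ operatorIndex A := by
  have hyE := (hH y).1 y.2
  have hcutoff (c : S) : (y : W).cutoff c ∈ H := (hH _).2 fun i hi =>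
    trace_cutoff_eq_zero (Ioo_subset_Icc_self (hS c c.2).1) (hS c c.2).2 (hyE i hi)
  let v : S → H := fun c => ⟨(y : W).cutoff c, hcutoff c⟩
  have hsum (a : S → ℂ) : ((∑ c, a c • v c : H) : W) = ∑ c, a c • (y : W).cutoff c := by
    simp only [v, Submodule.coe_sum, Submodule.coe_smul]
  obtain ⟨u, hu⟩ := exists_isSolution_of_apply_eq_zero hH hA hAy
  rw [← Fintype.card_coe]
  refine card_le_operatorIndex (isSymmetric_of_inner_eq_form hA) v (fun c e => ?_) fun a ha => ?_
  · rw [hA]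
    exact form_cutoff_cutoff_eq_zero hyE (form_eq_zero_of_apply_eq_zero hH hA hAy)
      (Ioo_subset_Icc_self (hS c c.2).1) (Ioo_subset_Icc_self (hS e e.2).1) (hS c c.2).2
      (hS e e.2).2
  · obtain ⟨w, hw⟩ := exists_isSolution_of_apply_eq_zero hH hA ha
    exact hu.eq_zero_of_sum_cutoff_eq_zero (fun h => hy (Subtype.ext h)) hS
      (IsSolution.sum_cutoff_eq_zero hS (hsum a ▸ hw))

theorem encard_zeros_le_operatorIndex {y : H} (hy : y ≠ 0) (hAy : A y = 0) :
    {x : ℝ | x ∈ Ioo (0 : ℝ) 1 ∧ (y : W).val x = 0}.encard ≤ operatorIndex A := by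
  refine ENat.forall_natCast_le_iff_le.1 fun n hn => ?_
  obtain ⟨T, hT, hcard⟩ := exists_subset_encard_eq hn
  have hfin := finite_of_encard_eq_coe hcard
  rw [← hcard, hfin.encard_eq_coe_toFinset_card]
  exact card_zeros_le_operatorIndex hH hA hy hAy fun c hc => hT (hfin.mem_toFinset.1 hc)

end Index

end LowerBound

section Zeros

theorem sq_integral_norm_le {α F : Type*} [MeasurableSpace α] [NormedAddCommGroup F]
    {μ : Measure α} [IsFiniteMeasure μ] {f : α → F} (hf : MemLp f 2 μ) :
    (∫ x, ‖f x‖ ∂μ) ^ 2 ≤ μ.real univ * ∫ x, ‖f x‖ ^ 2 ∂μ := by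
  have hholder := integral_mul_le_Lp_mul_Lq_of_nonneg (μ := μ) (f := fun _ => 1)
    Real.HolderConjugate.two_two (ae_of_all _ fun _ => zero_le_one)
    (ae_of_all _ fun x => norm_nonneg (f x)) (memLp_const _) (by simpa using hf.norm)
  simp only [one_mul, integral_const, smul_eq_mul, mul_one, one_pow, Real.rpow_two,
    ← Real.sqrt_eq_rpow] at hholder
  calc (∫ x, ‖f x‖ ∂μ) ^ 2 ≤ (√(μ.real univ) * √(∫ x, ‖f x‖ ^ 2 ∂μ)) ^ 2 := by gcongr
    _ = μ.real univ * ∫ x, ‖f x‖ ^ 2 ∂μ := by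
      rw [mul_pow, Real.sq_sqrt measureReal_nonneg, Real.sq_sqrt (by positivity)]

theorem W.norm_val_sub_sq_le (z : W) {x₀ x : ℝ} (hx₀ : x₀ ∈ Icc (0 : ℝ) 1)
    (hx : x ∈ Icc (0 : ℝ) 1) :
    ‖z.val x - z.val x₀‖ ^ 2 ≤ |x - x₀| * |∫ t in x₀..x, ‖z.deriv t‖ ^ 2| := by
  have hsub : uIcc x₀ x ⊆ Icc 0 1 := uIcc_subset_Icc hx₀ hx
  have hmemLp : MemLp z.deriv 2 (volume.restrict (uIoc x₀ x)) :=
    (Lp.memLp z.deriv).mono_measure (Measure.restrict_mono (uIoc_subset_uIcc.trans hsub) le_rfl)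
  have : IsFiniteMeasure (volume.restrict (uIoc x₀ x)) :=
    inferInstanceAs (IsFiniteMeasure (volume.restrict (Ioc _ _)))
  have hlength : (volume.restrict (uIoc x₀ x)).real univ = |x - x₀| := by
    rw [measureReal_restrict_apply_univ, uIoc, Real.volume_real_Ioc_of_le min_le_max,
      max_sub_min_eq_abs]
  have hderiv := intervalIntegrable_of_integrable z.deriv.integrable hx₀ hx
  rw [← uIcc_of_le zero_le_one] at hsub
  rw [← (z.hasACDerivOn_val.mono hsub).integral_eq_sub hderiv]
  calc ‖∫ t in x₀..x, z.deriv t‖ ^ 2 ≤ (∫ t in uIoc x₀ x, ‖z.deriv t‖) ^ 2 := by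
        gcongr
        exact intervalIntegral.norm_integral_le_integral_norm_uIoc
    _ ≤ |x - x₀| * ∫ t in uIoc x₀ x, ‖z.deriv t‖ ^ 2 := hlength ▸ sq_integral_norm_le hmemLp
    _ = |x - x₀| * |∫ t in x₀..x, ‖z.deriv t‖ ^ 2| := by
      rw [intervalIntegral.abs_integral_eq_abs_integral_uIoc, abs_of_nonneg
        (integral_nonneg fun t => by positivity)]

theorem HasACDerivOn.mul_abs_sub_le {f f' : ℝ → ℝ} {a b κ : ℝ} (h : HasACDerivOn f f' a b)
    (hf' : ∀ᵐ x, x ∈ uIcc a b → κ ≤ f' x) : κ * |b - a| ≤ |f b - f a| := by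
  have hlin : HasACDerivOn (fun x => ∫ _ in a..x, -κ) (fun _ => -κ) a b :=
    .primitive intervalIntegrable_const
  have hmono := (h.add hlin).monotoneOn (hf'.mono fun x hx hmem => by linarith [hx hmem])
  rcases le_total a b with hab | hba
  · have hle := hmono left_mem_uIcc right_mem_uIcc hab
    simp only [intervalIntegral.integral_const, smul_eq_mul, sub_self, zero_mul] at hle
    rw [abs_of_nonneg (sub_nonneg.2 hab)]
    linarith [le_abs_self (f b - f a)]
  · have hle := hmono right_mem_uIcc left_mem_uIcc hba
    simp only [intervalIntegral.integral_const, smul_eq_mul, sub_self, zero_mul] at hle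
    rw [abs_of_nonpos (sub_nonpos.2 hba)]
    linarith [neg_abs_le (f b - f a)]

namespace SturmData

theorem upper_pos (d : SturmData) : 0 < d.upper := by
  obtain ⟨x, hl, hu⟩ := (d.lower_le.and d.le_upper).exists
  exact d.lower_pos.trans_le (hl.trans hu)

/-- The integrating factor `exp (∫₀ˣ a / p)` of the equation `p y' + a y = u`. -/
def integratingFactor (d : SturmData) (x : ℝ) : ℝ := Real.exp (∫ t in 0..x, d.a t / d.p t)

theorem integratingFactor_pos (d : SturmData) (x : ℝ) : 0 < d.integratingFactor x :=
  Real.exp_pos _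

theorem hasACDerivOn_integratingFactor (d : SturmData) : HasACDerivOn d.integratingFactor
    (fun x => d.integratingFactor x * (d.a x / d.p x)) 0 1 := by
  have hint : Integrable (fun x => d.a x / d.p x) unitMeasure := by
    refine ((d.memLp_a.integrable one_le_two).norm.div_const d.lower).mono'
      (d.memLp_a.1.div₀ d.aestronglyMeasurable_p) ?_
    filter_upwards [d.lower_le] with x hx
    rw [norm_div]
    gcongr
    · exact d.lower_pos
    · exact hx.trans (le_abs_self _)
  exact (HasACDerivOn.primitive (intervalIntegrable_of_integrable hint unitInterval.zero_mem
    unitInterval.one_mem)).exp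

variable {d : SturmData} {y : W} {u : ℝ → ℂ}

theorem IsSolution.hasACDerivOn_integratingFactor_mul (h : d.IsSolution y u) :
    HasACDerivOn (fun x => d.integratingFactor x * y.val x)
      (fun x => (d.integratingFactor x / d.p x : ℝ) * u x) 0 1 := by
  refine (d.hasACDerivOn_integratingFactor.ofReal.mul y.hasACDerivOn_val).congr_deriv ?_
  rw [← ae_unitMeasure_iff]
  filter_upwards [h.ae_eq, d.lower_le] with x hux hpx
  have hp : (d.p x : ℂ) ≠ 0 := Complex.ofReal_ne_zero.2 (d.lower_pos.trans_le hpx).ne'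
  rw [hux, quasiDeriv]
  push_cast
  field_simp
  ring

theorem IsSolution.div_mul_abs_sub_le (h : d.IsSolution y u) {c : ℂ} {x₀ x m : ℝ}
    (hsub : uIcc x₀ x ⊆ uIcc 0 1) (hy : y.val x₀ = 0) (hm : 0 ≤ m)
    (hu : ∀ t ∈ uIcc x₀ x, m ≤ d.integratingFactor t * (c * u t).re) :
    m / d.upper * |x - x₀| ≤ ‖c‖ * d.integratingFactor x * ‖y.val x‖ := by
  have hac := (h.hasACDerivOn_integratingFactor_mul.clm_comp
    (ContinuousLinearMap.mul ℝ ℂ c)).re.mono hsub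
  have hgrowth := hac.mul_abs_sub_le (κ := m / d.upper) <| by
    filter_upwards [ae_unitMeasure_iff.1 d.lower_le, ae_unitMeasure_iff.1 d.le_upper]
      with t hl hup ht
    calc m / d.upper ≤ d.integratingFactor t * (c * u t).re / d.p t :=
          div_le_div₀ (hm.trans (hu t ht)) (hu t ht) (d.lower_pos.trans_le (hl (hsub ht)))
            (hup (hsub ht))
      _ = (c * ((d.integratingFactor t / d.p t : ℝ) * u t)).re := by
        rw [mul_left_comm, Complex.re_ofReal_mul]
        ring
  calc m / d.upper * |x - x₀| ≤ ‖c * (d.integratingFactor x * y.val x)‖ :=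
        hgrowth.trans <| by
          simpa only [ContinuousLinearMap.mul_apply', hy, mul_zero, Complex.zero_re, sub_zero]
            using Complex.abs_re_le_norm _
    _ = ‖c‖ * d.integratingFactor x * ‖y.val x‖ := by
      rw [norm_mul, norm_mul, Complex.norm_of_nonneg (d.integratingFactor_pos x).le, mul_assoc]

theorem IsSolution.exists_mul_abs_sub_le_norm_val (h : d.IsSolution y u) {x₀ : ℝ}
    (hx₀ : x₀ ∈ Icc (0 : ℝ) 1) (hy : y.val x₀ = 0) (hu : u x₀ ≠ 0) :
    ∃ κ > 0, ∀ᶠ x in nhdsWithin x₀ (Icc 0 1), κ * |x - x₀| ≤ ‖y.val x‖ := by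
  have hE := d.hasACDerivOn_integratingFactor.continuousOn_Icc zero_le_one
  let g : ℝ → ℝ := fun x => d.integratingFactor x * (conj (u x₀) * u x).re
  have hg : ContinuousOn g (Icc 0 1) := hE.mul (Complex.continuous_re.comp_continuousOn
    (continuousOn_const.mul (h.hasACDerivOn.continuousOn_Icc zero_le_one)))
  have hg₀ : 0 < g x₀ := by
    refine mul_pos (d.integratingFactor_pos x₀) ?_
    rw [← Complex.normSq_eq_conj_mul_self, Complex.ofReal_re]
    exact Complex.normSq_pos.2 hu
  have hlarge : ∀ᶠ x in nhdsWithin x₀ (Icc 0 1), ∀ t ∈ uIcc x₀ x, g x₀ / 2 < g t :=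
    (tendsto_const_nhdsWithin hx₀).uIcc Filter.tendsto_id
      (Filter.eventually_smallSets_forall.2 ((hg x₀ hx₀).eventually_const_lt (half_lt_self hg₀)))
  have hbounded : ∀ᶠ x in nhdsWithin x₀ (Icc 0 1),
      d.integratingFactor x < 2 * d.integratingFactor x₀ :=
    (hE x₀ hx₀).eventually_lt_const (lt_two_mul_self (d.integratingFactor_pos x₀))
  have hC : 0 < ‖conj (u x₀)‖ * (2 * d.integratingFactor x₀) :=
    mul_pos (norm_pos_iff.2 ((map_ne_zero _).2 hu)) (mul_pos two_pos (d.integratingFactor_pos x₀))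
  refine ⟨g x₀ / 2 / d.upper / (‖conj (u x₀)‖ * (2 * d.integratingFactor x₀)),
    div_pos (div_pos (half_pos hg₀) d.upper_pos) hC, ?_⟩
  filter_upwards [hlarge, hbounded, self_mem_nhdsWithin] with x hgx hEx hx
  have hsub : uIcc x₀ x ⊆ uIcc 0 1 := by
    rw [uIcc_of_le (zero_le_one' ℝ)]
    exact uIcc_subset_Icc hx₀ hx
  rw [div_mul_eq_mul_div, div_le_iff₀' hC]
  exact (h.div_mul_abs_sub_le hsub hy (half_pos hg₀).le fun t ht => (hgx t ht).le).trans
    (by gcongr)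

end SturmData

end Zeros

section Picone

theorem exists_eq_ofReal_mul_of_im_mul_conj_eq_zero {w y : ℂ} (hy : y ≠ 0)
    (hw : (w * conj y).im = 0) : ∃ g : ℝ, w = g * y := by
  refine ⟨(w / y).re, ?_⟩
  have him : (w / y).im = 0 := by
    rw [div_eq_mul_inv, Complex.inv_def, ← mul_assoc, Complex.im_mul_ofReal, hw, zero_mul]
  rw [← (Complex.conj_eq_iff_re.1 (Complex.conj_eq_iff_im.2 him)).symm, div_mul_cancel₀ w hy]

/- The left side is the derivative of `(u ȳ).re * (|z|² (|y|²)⁻¹)` by the product rule, for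
`u = p y' + a y` and `u' = a y' + b y`. -/
theorem picone_identity {p : ℝ} (a b : ℝ) (hp : p ≠ 0) {y y' : ℂ} (z z' : ℂ)
    (hy : y ≠ 0) (hu : ((p * y' + a * y) * conj y).im = 0) :
    ((a * y' + b * y) * conj y + (p * y' + a * y) * conj y').re * (‖z‖ ^ 2 * (‖y‖ ^ 2)⁻¹) +
        ((p * y' + a * y) * conj y).re * (2 * inner ℝ z z' * (‖y‖ ^ 2)⁻¹ +
          ‖z‖ ^ 2 * (-((‖y‖ ^ 2) ^ 2)⁻¹ * (2 * inner ℝ y y'))) =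
      (p * z' * conj z' + (a * (z' * conj z + z * conj z') + b * (z * conj z))).re -
        p * ‖z' - y' / y * z‖ ^ 2 := by
  have hy' : (y' * conj y).im = 0 := by
    rw [add_mul, mul_assoc, mul_assoc, Complex.add_im, Complex.im_ofReal_mul,
      Complex.im_ofReal_mul, Complex.mul_conj, Complex.ofReal_im, mul_zero, add_zero] at hu
    exact (mul_eq_zero.1 hu).resolve_left hp
  obtain ⟨g, rfl⟩ := exists_eq_ofReal_mul_of_im_mul_conj_eq_zero hy hy'
  have hy_sq : y.re ^ 2 + y.im ^ 2 ≠ 0 := by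
    simpa only [Complex.normSq_apply, ← sq] using (Complex.normSq_pos.2 hy).ne'
  rw [mul_div_cancel_right₀ _ hy]
  simp only [← Complex.normSq_eq_norm_sq, Complex.normSq_apply, Complex.inner,
    Complex.add_re, Complex.mul_re, Complex.mul_im, Complex.add_im, Complex.sub_re,
    Complex.sub_im, Complex.conj_re, Complex.conj_im, Complex.ofReal_re, Complex.ofReal_im]
  field_simp
  ring

namespace SturmData

variable {d : SturmData} {y z : W} {u : ℝ → ℂ}

theorem IsSolution.im_mul_conj_eq_zero (h : d.IsSolution y u)
    (h₀ : (u 0 * conj (y.val 0)).im = 0) {x : ℝ} (hx : x ∈ Icc (0 : ℝ) 1) :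
    (u x * conj (y.val x)).im = 0 := by
  have hwronskian : HasACDerivOn (fun x => (u x * conj (y.val x)).im) (fun _ => 0) 0 1 := by
    refine (h.hasACDerivOn.mul y.hasACDerivOn_val.star).im.congr_deriv ?_
    rw [← ae_unitMeasure_iff]
    filter_upwards [h.ae_eq] with x hux
    rw [hux, quasiDeriv, rate]
    simp only [Complex.add_im, Complex.mul_im, Complex.add_re, Complex.mul_re, Complex.conj_re,
      Complex.conj_im, Complex.ofReal_re, Complex.ofReal_im]
    ring
  have hsub : uIcc 0 x ⊆ uIcc 0 1 := uIcc_subset_uIcc left_mem_uIcc (Icc_subset_uIcc hx)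
  have hconst := (hwronskian.mono hsub).integral_eq_sub intervalIntegrable_const
  rw [intervalIntegral.integral_zero, h₀, sub_zero] at hconst
  exact hconst.symm

/-- The boundary term `(u / y) |z|²` of Picone's identity. It is written with `u ȳ / |y|²` in place
of `u / y` so as to be differentiated over the reals; at the zeros of `y` it takes the value `0`. -/
def picone (y z : W) (u : ℝ → ℂ) (x : ℝ) : ℝ :=
  (u x * conj (y.val x)).re * (‖z.val x‖ ^ 2 * (‖y.val x‖ ^ 2)⁻¹)

theorem picone_eq_zero {x : ℝ} (hz : z.val x = 0) : picone y z u x = 0 := by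
  simp [picone, hz]

theorem picone_eq_mul {x c : ℝ} (hy : y.val x ≠ 0) (hu : u x = c * y.val x) :
    picone y z u x = c * ‖z.val x‖ ^ 2 := by
  have hre : (u x * conj (y.val x)).re = c * ‖y.val x‖ ^ 2 := by
    rw [hu, mul_assoc, Complex.mul_conj', ← Complex.ofReal_pow, ← Complex.ofReal_mul,
      Complex.ofReal_re]
  have := norm_ne_zero_iff.2 hy
  rw [picone, hre]
  field_simp

theorem abs_picone_le (y z : W) (u : ℝ → ℂ) (x : ℝ) :
    |picone y z u x| ≤ ‖u x‖ * (‖z.val x‖ ^ 2 / ‖y.val x‖) := by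
  rcases eq_or_ne (y.val x) 0 with hy | hy
  · simp [picone, hy]
  have hy_norm := norm_ne_zero_iff.2 hy
  calc |picone y z u x| = |(u x * conj (y.val x)).re| * (‖z.val x‖ ^ 2 * (‖y.val x‖ ^ 2)⁻¹) := by
        rw [picone, abs_mul, abs_of_nonneg (by positivity : 0 ≤ ‖z.val x‖ ^ 2 * _)]
    _ ≤ ‖u x * conj (y.val x)‖ * (‖z.val x‖ ^ 2 * (‖y.val x‖ ^ 2)⁻¹) := by
        gcongr
        exact Complex.abs_re_le_norm _
    _ = ‖u x‖ * (‖z.val x‖ ^ 2 / ‖y.val x‖) := by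
        rw [norm_mul, RCLike.norm_conj]
        field_simp

theorem IsSolution.hasACDerivOn_picone (h : d.IsSolution y u)
    (hreal : ∀ x ∈ Icc (0 : ℝ) 1, (u x * conj (y.val x)).im = 0) (z : W) {α β : ℝ}
    (hsub : uIcc α β ⊆ uIcc 0 1) (hy : ∀ x ∈ uIcc α β, y.val x ≠ 0) :
    HasACDerivOn (picone y z u) (fun x => (d.density z z x).re -
      d.p x * ‖z.deriv x - y.deriv x / y.val x * z.val x‖ ^ 2) α β := by
  have hyval := y.hasACDerivOn_val.mono hsub
  refine (((h.hasACDerivOn.mono hsub).mul hyval.star).re.mul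
    ((z.hasACDerivOn_val.mono hsub).norm_sq.mul (hyval.norm_sq.inv fun x hx =>
      pow_ne_zero 2 (norm_ne_zero_iff.2 (hy x hx))))).congr_deriv ?_
  filter_upwards [ae_unitMeasure_iff.1 h.ae_eq, ae_unitMeasure_iff.1 d.lower_le]
    with x hux hpx hx
  have hp : d.p x ≠ 0 := (d.lower_pos.trans_le (hpx (hsub hx))).ne'
  have him := hreal x (by simpa only [uIcc_of_le (zero_le_one' ℝ)] using hsub hx)
  rw [hux (hsub hx), quasiDeriv] at him ⊢
  exact picone_identity _ _ hp _ _ (hy x hx) him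

theorem IsSolution.monotoneOn_integral_density_sub_picone (h : d.IsSolution y u)
    (hreal : ∀ x ∈ Icc (0 : ℝ) 1, (u x * conj (y.val x)).im = 0) (z : W) {α β : ℝ}
    (hsub : uIcc α β ⊆ uIcc 0 1) (hy : ∀ x ∈ uIcc α β, y.val x ≠ 0) :
    MonotoneOn (fun x => (∫ t in (0 : ℝ)..x, (d.density z z t).re) - picone y z u x)
      (uIcc α β) := by
  have hprimitive : HasACDerivOn _ _ 0 1 := .primitive (intervalIntegrable_of_integrable
    (d.integrable_density z z).re unitInterval.zero_mem unitInterval.one_mem)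
  simp only [sub_eq_add_neg]
  refine ((hprimitive.mono hsub).add (h.hasACDerivOn_picone hreal z hsub hy).neg).monotoneOn ?_
  filter_upwards [ae_unitMeasure_iff.1 d.lower_le] with x hpx hx
  have hp := d.lower_pos.trans_le (hpx (hsub hx))
  simp only [RCLike.re_to_complex, neg_sub, add_sub_cancel]
  positivity

theorem IsSolution.tendsto_norm_val_sq_div (h : d.IsSolution y u) {x₀ : ℝ}
    (hx₀ : x₀ ∈ Icc (0 : ℝ) 1) (hy : y.val x₀ = 0) (hu : u x₀ ≠ 0) (hz : z.val x₀ = 0) :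
    Filter.Tendsto (fun x => ‖z.val x‖ ^ 2 / ‖y.val x‖) (nhdsWithin x₀ (Icc 0 1)) (nhds 0) := by
  obtain ⟨κ, hκ, hlinear⟩ := h.exists_mul_abs_sub_le_norm_val hx₀ hy hu
  have henergy : Filter.Tendsto (fun x => |∫ t in x₀..x, ‖z.deriv t‖ ^ 2| / κ)
      (nhdsWithin x₀ (Icc 0 1)) (nhds 0) := by
    have hprimitive := intervalIntegral.continuousOn_primitive_interval'
      (intervalIntegrable_of_integrable (Lp.memLp z.deriv).integrable_norm_pow'
        unitInterval.zero_mem unitInterval.one_mem) (Icc_subset_uIcc hx₀)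
    rw [uIcc_of_le zero_le_one] at hprimitive
    simpa using ((hprimitive x₀ hx₀).abs.div_const κ).tendsto
  refine squeeze_zero' (.of_forall fun x => by positivity) ?_ henergy
  filter_upwards [hlinear, self_mem_nhdsWithin] with x hlin hx
  have hsq := z.norm_val_sub_sq_le hx₀ hx
  rw [hz, sub_zero] at hsq
  refine div_le_of_le_mul₀ (norm_nonneg _) (by positivity) ?_
  calc ‖z.val x‖ ^ 2 ≤ |x - x₀| * |∫ t in x₀..x, ‖z.deriv t‖ ^ 2| := hsq
    _ = |∫ t in x₀..x, ‖z.deriv t‖ ^ 2| / κ * (κ * |x - x₀|) := by field_simp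
    _ ≤ _ := by gcongr

theorem IsSolution.continuousOn_picone (h : d.IsSolution y u) (hy : y ≠ 0)
    (hz : ∀ x ∈ Icc (0 : ℝ) 1, y.val x = 0 → z.val x = 0) :
    ContinuousOn (picone y z u) (Icc 0 1) := by
  intro x₀ hx₀
  have hyc := y.hasACDerivOn_val.continuousOn_Icc zero_le_one x₀ hx₀
  have hzc := z.hasACDerivOn_val.continuousOn_Icc zero_le_one x₀ hx₀
  have huc := h.hasACDerivOn.continuousOn_Icc zero_le_one x₀ hx₀
  by_cases hyx₀ : y.val x₀ = 0
  · have hlim := Filter.Tendsto.mul huc.norm (h.tendsto_norm_val_sq_div hx₀ hyx₀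
      (h.ne_zero_of_val_eq_zero hy hx₀ hyx₀) (hz x₀ hx₀ hyx₀))
    rw [mul_zero] at hlim
    rw [ContinuousWithinAt, picone_eq_zero (hz x₀ hx₀ hyx₀)]
    exact squeeze_zero_norm (abs_picone_le y z u) hlim
  · have huy := huc.mul (Complex.continuous_conj.continuousAt.comp_continuousWithinAt hyc)
    exact (Complex.continuous_re.continuousAt.comp_continuousWithinAt huy).mul
      ((hzc.norm.pow 2).mul ((hyc.norm.pow 2).inv₀ (pow_ne_zero 2 (norm_ne_zero_iff.2 hyx₀))))

theorem IsSolution.eventually_val_ne_zero (h : d.IsSolution y u) (hy : y ≠ 0) {x₀ : ℝ}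
    (hx₀ : x₀ ∈ Ico (0 : ℝ) 1) : ∀ᶠ x in nhdsWithin x₀ (Ioi x₀), y.val x ≠ 0 := by
  have hle : nhdsWithin x₀ (Ioi x₀) ≤ nhdsWithin x₀ (Icc 0 1) := by
    rw [← nhdsWithin_Ioc_eq_nhdsGT hx₀.2]
    exact nhdsWithin_mono _ fun x hx => ⟨hx₀.1.trans hx.1.le, hx.2⟩
  have hmem := Ico_subset_Icc_self hx₀
  by_cases hyx₀ : y.val x₀ = 0
  · obtain ⟨κ, hκ, hlinear⟩ :=
      h.exists_mul_abs_sub_le_norm_val hmem hyx₀ (h.ne_zero_of_val_eq_zero hy hmem hyx₀)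
    filter_upwards [hle hlinear, self_mem_nhdsWithin] with x hlin hx
    exact norm_pos_iff.1 ((mul_pos hκ (abs_pos.2 (sub_pos.2 hx).ne')).trans_le hlin)
  · exact hle ((y.hasACDerivOn_val.continuousOn_Icc zero_le_one x₀ hmem).eventually_ne hyx₀)

end SturmData

end Picone

section UpperBound

theorem le_of_forall_exists_monotoneOn_Ioo {G : ℝ → ℝ} {a b : ℝ} (hab : a ≤ b)
    (hG : ContinuousOn G (Icc a b)) (hmono : ∀ x ∈ Ico a b, ∃ c > x, MonotoneOn G (Ioo x c)) :
    G a ≤ G b := by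
  have hclosed : IsClosed ({x | G a ≤ G x} ∩ Icc a b) := by
    rw [inter_comm]
    exact hG.preimage_isClosed_of_isClosed isClosed_Icc isClosed_Ici
  refine hclosed.Icc_subset_of_forall_mem_nhdsWithin (le_refl (G a)) (fun x hx => ?_)
    (right_mem_Icc.2 hab)
  obtain ⟨c, hxc, hmono⟩ := hmono x hx.2
  have hlt : x < min c b := lt_min hxc hx.2.2
  have hIoo := left_nhdsWithin_Ioo_neBot hlt
  have hmono_Ioo := hmono.mono (Ioo_subset_Ioo_right (min_le_left c b))
  have hmono_Ico := hmono_Ioo.insert_of_continuousWithinAt (x := x) hIoo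
    ((hG x (Ico_subset_Icc_self hx.2)).mono fun t ht =>
      ⟨hx.2.1.trans ht.1.le, ht.2.le.trans (min_le_right c b)⟩)
  rw [Ioo_insert_left hlt] at hmono_Ico
  filter_upwards [Ioo_mem_nhdsGT hlt] with t ht
  exact hx.1.trans (hmono_Ico (left_mem_Ico.2 hlt) (Ioo_subset_Ico_self ht) ht.1.le)

namespace SturmData

variable {d : SturmData} {y z : W} {u : ℝ → ℂ}

theorem IsSolution.picone_sub_le (h : d.IsSolution y u) (hy : y ≠ 0)
    (hreal : ∀ x ∈ Icc (0 : ℝ) 1, (u x * conj (y.val x)).im = 0)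
    (hz : ∀ x ∈ Icc (0 : ℝ) 1, y.val x = 0 → z.val x = 0) :
    picone y z u 1 - picone y z u 0 ≤ ∫ x in (0 : ℝ)..1, (d.density z z x).re := by
  let G : ℝ → ℝ := fun x => (∫ t in (0 : ℝ)..x, (d.density z z t).re) - picone y z u x
  have hint := intervalIntegrable_of_integrable (d.integrable_density z z).re
    unitInterval.zero_mem unitInterval.one_mem
  have hG : ContinuousOn G (Icc 0 1) :=
    ((HasACDerivOn.primitive hint).continuousOn_Icc zero_le_one).sub (h.continuousOn_picone hy hz)
  have hle : G 0 ≤ G 1 := by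
    refine le_of_forall_exists_monotoneOn_Ioo zero_le_one hG fun x hx => ?_
    obtain ⟨c, hxc, hc⟩ := (mem_nhdsGT_iff_exists_Ioo_subset' hx.2).1
      ((h.eventually_val_ne_zero hy hx).and (Ioo_mem_nhdsGT hx.2))
    refine ⟨c, hxc, fun s hs t ht hst => ?_⟩
    have hsub : uIcc s t ⊆ Ioo x c := ordConnected_Ioo.uIcc_subset hs ht
    refine h.monotoneOn_integral_density_sub_picone hreal z (fun τ hτ => ?_)
      (fun τ hτ => (hc (hsub hτ)).1) left_mem_uIcc right_mem_uIcc hst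
    exact Icc_subset_uIcc ⟨hx.1.trans (hsub hτ).1.le, (hc (hsub hτ)).2.2.le⟩
  simp only [G, intervalIntegral.integral_same] at hle
  linarith

theorem IsSolution.val_ne_zero_of_eq_mul (h : d.IsSolution y u) (hy : y ≠ 0) {x c : ℝ}
    (hx : x ∈ Icc (0 : ℝ) 1) (hux : u x = c * y.val x) : y.val x ≠ 0 := fun hyx =>
  h.ne_zero_of_val_eq_zero hy hx hyx (by rw [hux, hyx, mul_zero])

theorem IsSolution.picone_eq (h : d.IsSolution y u) (hy : y ≠ 0) {x c : ℝ}
    (hx : x ∈ Icc (0 : ℝ) 1) (hbc : z.val x = 0 ∨ u x = c * y.val x) :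
    picone y z u x = c * ‖z.val x‖ ^ 2 := by
  rcases hbc with hzx | hux
  · rw [picone_eq_zero hzx, hzx, norm_zero, zero_pow two_ne_zero, mul_zero]
  · exact picone_eq_mul (h.val_ne_zero_of_eq_mul hy hx hux) hux

theorem re_form_self (d : SturmData) (z : W) : (d.form z z).re =
    (∫ x in (0 : ℝ)..1, (d.density z z x).re) + ∑ i, d.v i * ‖trace z i‖ ^ 2 := by
  rw [form, Complex.add_re, Complex.re_sum, ← integral_unitMeasure]
  congr 1
  · exact (integral_re (d.integrable_density z z)).symm
  · simp only [Complex.mul_conj', ← Complex.ofReal_pow, ← Complex.ofReal_mul, Complex.ofReal_re]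

variable {E : Set (Fin 2)}

theorem IsSolution.form_nonneg (h : d.IsSolution y u) (hy : y ≠ 0)
    (hyE : ∀ i ∈ E, trace y i = 0)
    (hconormal : ∀ i, i ∉ E → conormal u i + d.v i * trace y i = 0)
    (hzE : ∀ i ∈ E, trace z i = 0) (hz : ∀ x ∈ Ioo (0 : ℝ) 1, y.val x = 0 → z.val x = 0) :
    0 ≤ (d.form z z).re := by
  have hE₀ (w : W) (hw : ∀ i ∈ E, trace w i = 0) :
      w.val 0 = 0 ∨ u 0 = (d.v 0 : ℝ) * y.val 0 := by
    refine (em (0 ∈ E)).imp (hw 0) fun hi => ?_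
    simpa [conormal, trace_zero, neg_add_eq_zero] using hconormal 0 hi
  have hE₁ (w : W) (hw : ∀ i ∈ E, trace w i = 0) :
      w.val 1 = 0 ∨ u 1 = (-d.v 1 : ℝ) * y.val 1 := by
    refine (em (1 ∈ E)).imp (hw 1) fun hi => ?_
    simpa [conormal, trace_one, add_eq_zero_iff_eq_neg] using hconormal 1 hi
  have hreal₀ : (u 0 * conj (y.val 0)).im = 0 := by
    rcases hE₀ y hyE with hy₀ | hu₀
    · rw [hy₀, map_zero, mul_zero, Complex.zero_im]
    · rw [hu₀, mul_assoc, Complex.mul_conj, ← Complex.ofReal_mul, Complex.ofReal_im]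
  have hzeros : ∀ x ∈ Icc (0 : ℝ) 1, y.val x = 0 → z.val x = 0 := fun x hx hyx => by
    rcases eq_endpoints_or_mem_Ioo_of_mem_Icc hx with rfl | rfl | hx'
    · exact (hE₀ z hzE).resolve_right fun hu₀ => h.val_ne_zero_of_eq_mul hy hx hu₀ hyx
    · exact (hE₁ z hzE).resolve_right fun hu₁ => h.val_ne_zero_of_eq_mul hy hx hu₁ hyx
    · exact hz x hx' hyx
  have hpicone := h.picone_sub_le hy (fun x hx => h.im_mul_conj_eq_zero hreal₀ hx) hzeros
  rw [h.picone_eq hy unitInterval.zero_mem (hE₀ z hzE),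
    h.picone_eq hy unitInterval.one_mem (hE₁ z hzE)] at hpicone
  rw [re_form_self, Fin.sum_univ_two, trace_zero, trace_one]
  linarith

end SturmData

section Index

open SturmData

variable {d : SturmData} {E : Set (Fin 2)} {H : Submodule ℂ W}
  (hH : ∀ z, z ∈ H ↔ ∀ i ∈ E, trace z i = 0) {A : H →L[ℂ] H}
  (hA : ∀ w z : H, inner ℂ z (A w) = d.form w z)
include hH hA

theorem operatorIndex_le_encard_zeros {y : H} (hy : y ≠ 0) (hAy : A y = 0) :
    operatorIndex A ≤ {x : ℝ | x ∈ Ioo (0 : ℝ) 1 ∧ (y : W).val x = 0}.encard := by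
  set S := {x : ℝ | x ∈ Ioo (0 : ℝ) 1 ∧ (y : W).val x = 0}
  rcases S.finite_or_infinite with hfin | hinf
  swap
  · exact hinf.encard_eq ▸ le_top
  have := hfin.fintype
  obtain ⟨u, hu⟩ := exists_isSolution_of_apply_eq_zero hH hA hAy
  let evalZeros : H →ₗ[ℂ] S → ℂ :=
    LinearMap.pi fun c => W.eval (Ioo_subset_Icc_self c.2.1) ∘ₗ H.subtype
  have hindex : operatorIndex A ≤ Module.finrank ℂ (S → ℂ) :=
    formIndex_le_finrank evalZeros fun z hz => by
      have hform : 0 ≤ (d.form z z).re := hu.form_nonneg (Subtype.coe_ne_coe.2 hy)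
        ((hH y).1 y.2)
        (fun i hi => hu.conormal_add_eq_zero (form_eq_zero_of_apply_eq_zero hH hA hAy) hi)
        ((hH z).1 z.2) fun x hx hyx => congrFun hz ⟨x, hx, hyx⟩
      rwa [ContinuousLinearMap.reApplyInnerSelf_apply, inner_re_symm, hA]
  rwa [Module.finrank_fintype_fun_eq_card, Set.coe_fintypeCard] at hindex

end Index

end UpperBound

end SturmLiouville

end

theorem mainTheorem4_general
    (p : Lp ℝ ∞ SturmLiouville.unitMeasure)
    (hp : ∃ c : ℝ, 0 < c ∧ ∀ᵐ x ∂SturmLiouville.unitMeasure, c ≤ p x)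
    (q r : SturmLiouville.WNeg) (hq : q.IsReal) (hr : r.IsReal)
    (U : Matrix (Fin 2) (Fin 2) ℂ) (hdiag : U.IsDiag)
    (lam : ℝ) (y : SturmLiouville.HU U) (hy : y ≠ 0)
    (heigen : SturmLiouville.pencil p q r U (lam : ℂ) y = 0) :
    SturmLiouville.operatorIndex (SturmLiouville.plusPencil p q r U (lam : ℂ)) =
      {x : ℝ | x ∈ Ioo (0 : ℝ) 1 ∧ SturmLiouville.W.val (y : SturmLiouville.W) x = 0}.encard := by
  obtain ⟨d, hd⟩ := SturmLiouville.exists_sturmData p hp q r hq hr U lam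
  have hH (z : SturmLiouville.W) :
      z ∈ SturmLiouville.HU U ↔ ∀ i ∈ {i | U i i = 1}, SturmLiouville.trace z i = 0 :=
    SturmLiouville.mem_HU_iff hdiag
  have hA (w z : SturmLiouville.HU U) :
      inner ℂ z (SturmLiouville.plusPencil p q r U (lam : ℂ) w) = d.form w z := by
    rw [SturmLiouville.inner_plusPencil, hd]
  have hker : SturmLiouville.plusPencil p q r U (lam : ℂ) y = 0 := by
    rw [SturmLiouville.plusPencil, ContinuousLinearMap.comp_apply, heigen, map_zero]
  exact le_antisymm (SturmLiouville.operatorIndex_le_encard_zeros hH hA hy hker)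
    (SturmLiouville.encard_zeros_le_operatorIndex hH hA hy hker)

theorem mainTheorem4
    (p : Lp ℝ ∞ SturmLiouville.unitMeasure)
    (hp : ∃ c : ℝ, 0 < c ∧ ∀ᵐ x ∂SturmLiouville.unitMeasure, c ≤ p x)
    (q r : SturmLiouville.WNeg) (hq : q.IsReal) (hr : r.IsReal)
    (U : Matrix (Fin 2) (Fin 2) ℂ) (hU : U ∈ Matrix.unitaryGroup (Fin 2) ℂ) (hdiag : U.IsDiag)
    (lam : ℝ) (y : SturmLiouville.HU U) (hy : y ≠ 0)
    (heigen : SturmLiouville.pencil p q r U (lam : ℂ) y = 0) :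
    SturmLiouville.operatorIndex (SturmLiouville.plusPencil p q r U (lam : ℂ)) =
      {x : ℝ | x ∈ Ioo (0 : ℝ) 1 ∧ SturmLiouville.W.val (y : SturmLiouville.W) x = 0}.encard := by
  exact mainTheorem4_general p hp q r hq hr U hdiag lam y hy heigen
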